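/- Let $k\ge 1$ and let $\mu$ be a self-similar measure on $\mathbb{R}^k$: there are $N\ge 2$ similarities $f_i(x)=r_iO_ix+t_i$ with $0<r_i<1$, $O_i\in O_k(\mathbb{R})$, $t_i\in\mathbb{R}^k$, not all sharing a common fixed point, and weights $p_i\in(0,1)$ with $\sum_i p_i=1$, such that $\mu$ is the Borel probability measure with $\mu=\sum_i p_i\, f_i(\mu)$ supported on the compact attractor $K=\bigcup_i f_i(K)$. Assume that $\mu$ is non-expanding, i.e. that such a system can be chosen so that for every $\varepsilon>0$ the number of distinct products $O_{i_1}\cdots O_{i_n}$ of length $n$ is $\ll_\varepsilon e^{\varepsilon n}$. For a finite measure $\nu$ on a Euclidean space write $\widehat\nu(\xi)=\int e^{-2\pi i\langle \xi,x\rangle}\,d\nu(x)$, and define - for $p\in\{1,2\}$, $\kappa_p=\sup\{0\le s<k:\ \int_{B(0,R)}|\widehat\mu(\xi)|^p\,d\xi\ll R^{k-s}\text{ for all }R>0\}$ (the Fourier $l^1$ dimension $\kappa_1$ and the lower correlation dimension $\kappa_2$); - $d_\infty=\sup\{s\ge 0:\ \mu(B_r(x))\ll r^s \text{ uniformly in }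 x\in\mathbb{R}^k,\ r>0\}$ (the Frostman exponent); - $\kappa_*=\inf\{\alpha\ge0:\ \exists C>0\ \forall\, 0<r<R\ \forall x\in \operatorname{supp}\mu,\ N_r(B_R(x)\cap\operatorname{supp}\mu)\le C(R/r)^\alpha\}$ (the Assouad dimension of $\operatorname{supp}\mu$), where $N_r(A)$ is the least number of open balls of diameter $r$ needed to cover $A$. Assume $\kappa_2>k/2$. Let $f\colon\mathbb{R}^k\to\mathbb{R}$ be $C^2$ such that the graph $\{(x,f(x)):x\in\mathbb{R}^k\}\subset\mathbb{R}^{k+1}$ has non-vanishing Gaussian curvature at $(x,f(x))$ for every $x\in\operatorname{supp}\mu$, and let $\mu_f$ be the pushforward of $\mu$ under $f$. Then there is some $\sigma>0$ with $$|\widehat{\mu_f}(\xi)|\ll|\xi|^{-\sigma}\qquad\text{for all }\xi\in\mathbb{R}\setminus\{0\}.$$ More precisely, this bound holds (with an implicit constant that may depend on $\mu$, $f$ and $\sigma$) for every $\sigma$ with $$0<\sigma<\frac{2\kappa_2-k}{4+2\kappa_*-k},$$ and, if moreover $d_\infty+\kappa_1>k$, for every $\sigma$ with $$0<\sigma<\max\left\{\frac{2\kappa_2-k}{4+2\kappa_*-k},\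 \frac{d_\infty+\kappa_1-k}{2-k+2\kappa_*+\kappa_1-d_\infty}\right\}.$$ -/

import Mathlib

open MeasureTheory
open scoped Pointwise

noncomputable section

namespace FourierDecay

/-- The Fourier transform of a measure on a Euclidean space, with kernel `e^{-2πi⟨ξ, x⟩}`. -/
def fourierTransform {E : Type*} [NormedAddCommGroup E] [InnerProductSpace ℝ E]
    [MeasurableSpace E] (μ : Measure E) (ξ : E) : ℂ :=
  ∫ x, Complex.exp (-2 * (Real.pi : ℂ) * Complex.I * ((inner ℝ ξ x : ℝ) : ℂ)) ∂μ

/-! ### Dimensions -/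

/-- The Fourier `l^p` dimension of a measure on `ℝ^k`: the supremum of all `0 ≤ s < k` with
`∫_{B(0,R)} |μ̂(ξ)|^p dξ ≪ R^{k-s}`. For `p = 2` and compactly supported probability measures this
is the lower correlation dimension `κ₂`; for `p = 1` it is `κ₁`. -/
def fourierDim {k : ℕ} (p : ℝ) (μ : Measure (EuclideanSpace ℝ (Fin k))) : ℝ :=
  sSup {s : ℝ | 0 ≤ s ∧ s < k ∧ ∃ C : ℝ, ∀ R : ℝ, 0 < R →
    ∫ ξ in Metric.ball (0 : EuclideanSpace ℝ (Fin k)) R, ‖fourierTransform μ ξ‖ ^ p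
      ≤ C * R ^ ((k : ℝ) - s)}

/-- The (uniform) Frostman exponent `d_∞` of a measure on `ℝ^k`. -/
def frostmanExponent {k : ℕ} (μ : Measure (EuclideanSpace ℝ (Fin k))) : ℝ :=
  sSup {s : ℝ | 0 ≤ s ∧ ∃ C : ℝ, ∀ (x : EuclideanSpace ℝ (Fin k)) (r : ℝ), 0 < r →
    μ.real (Metric.ball x r) ≤ C * r ^ s}

/-- The smallest number of open balls of diameter `δ` (radius `δ / 2`) needed to cover a bounded
set `A` of `ℝ^k`. -/
def ballCoveringNumber {k : ℕ} (δ : ℝ) (A : Set (EuclideanSpace ℝ (Fin k))) : ℕ :=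
  sInf {m : ℕ | ∃ t : Finset (EuclideanSpace ℝ (Fin k)), t.card = m ∧
    A ⊆ ⋃ y ∈ t, Metric.ball y (δ / 2)}

/-- The Assouad dimension of a subset of `ℝ^k`. -/
def assouadDim {k : ℕ} (E : Set (EuclideanSpace ℝ (Fin k))) : ℝ :=
  sInf {α : ℝ | 0 ≤ α ∧ ∃ C : ℝ, 0 < C ∧ ∀ r R : ℝ, 0 < r → r < R → ∀ x ∈ E,
    (ballCoveringNumber r (Metric.ball x R ∩ E) : ℝ) ≤ C * (R / r) ^ α}

/-! ### Self-similar measures -/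

/-- A finite subset `F` of a group is non-expanding if, for every `ε > 0`, the set `F ^ n` of
products of `n` elements of `F` has cardinality `≪ e^{εn}`. -/
def NonExpanding {G : Type*} [Group G] (F : Set G) : Prop :=
  F.Finite ∧ ∀ ε : ℝ, 0 < ε → ∃ C : ℝ, ∀ n : ℕ, ((F ^ n).ncard : ℝ) ≤ C * Real.exp (ε * n)

/-- A self-similar iterated function system on `ℝ^k`: at least two contracting similarities
`x ↦ rᵢ Oᵢ x + tᵢ` which do not all share a common fixed point. -/
structure SelfSimilarIFS (k : ℕ) where
  /-- the number of maps -/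
  N : ℕ
  one_lt_N : 1 < N
  /-- the contraction ratios -/
  ratio : Fin N → ℝ
  ratio_pos : ∀ i, 0 < ratio i
  ratio_lt_one : ∀ i, ratio i < 1
  /-- the orthogonal parts -/
  rot : Fin N → (EuclideanSpace ℝ (Fin k) ≃ₗᵢ[ℝ] EuclideanSpace ℝ (Fin k))
  /-- the translation parts -/
  trans : Fin N → EuclideanSpace ℝ (Fin k)
  no_common_fixed_point : ¬ ∃ x, ∀ i, ratio i • rot i x + trans i = x

namespace SelfSimilarIFS

variable {k : ℕ}

/-- The similarity `x ↦ rᵢ Oᵢ x + tᵢ`. -/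
def map (Λ : SelfSimilarIFS k) (i : Fin Λ.N) (x : EuclideanSpace ℝ (Fin k)) :
    EuclideanSpace ℝ (Fin k) :=
  Λ.ratio i • Λ.rot i x + Λ.trans i

/-- `μ` is a self-similar measure of the system: a Borel probability measure supported on the
attractor `K` with `μ = ∑ pᵢ fᵢ(μ)` for some probability vector with entries in `(0, 1)`. -/
def IsSelfSimilarMeasure (Λ : SelfSimilarIFS k) (μ : Measure (EuclideanSpace ℝ (Fin k))) : Prop :=
  IsProbabilityMeasure μ ∧
  (∃ K : Set (EuclideanSpace ℝ (Fin k)), IsCompact K ∧ K = ⋃ i, Λ.map i '' K ∧ μ Kᶜ = 0) ∧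
  ∃ p : Fin Λ.N → ℝ, (∀ i, 0 < p i ∧ p i < 1) ∧ ∑ i, p i = 1 ∧
    μ = ∑ i, ENNReal.ofReal (p i) • μ.map (Λ.map i)

end SelfSimilarIFS

/-- `μ` is a non-expanding self-similar measure: it is a self-similar measure of at least one
self-similar system whose set of orthogonal parts is non-expanding. -/
def IsNonExpandingSelfSimilar {k : ℕ} (μ : Measure (EuclideanSpace ℝ (Fin k))) : Prop :=
  ∃ Λ : SelfSimilarIFS k, NonExpanding (Set.range Λ.rot) ∧ Λ.IsSelfSimilarMeasure μ

/-! ### Gaussian curvature of a graph -/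

/-- The (upward) unit normal `(-∇f(x), 1) / √(1 + |∇f(x)|²)` of the graph of `f` at the point
`(x, f(x))`: the Gauss map of the graph, in the chart `x ↦ (x, f(x))`. -/
def graphNormal {k : ℕ} (f : EuclideanSpace ℝ (Fin k) → ℝ) (x : EuclideanSpace ℝ (Fin k)) :
    WithLp 2 (EuclideanSpace ℝ (Fin k) × ℝ) :=
  (Real.sqrt (1 + ‖gradient f x‖ ^ 2))⁻¹ • WithLp.toLp 2 (-gradient f x, (1 : ℝ))

/-- The shape operator (differential of the Gauss map) of the graph of a `C²` function `f` at
`(x, f(x))`. It is an endomorphism of the tangent space `{(v, f'(x) v)}`, which is identified with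
`ℝ^k` by taking the first component. -/
def graphShapeOperator {k : ℕ} (f : EuclideanSpace ℝ (Fin k) → ℝ)
    (x : EuclideanSpace ℝ (Fin k)) :
    EuclideanSpace ℝ (Fin k) →ₗ[ℝ] EuclideanSpace ℝ (Fin k) :=
  ((WithLp.fstL 2 ℝ (EuclideanSpace ℝ (Fin k)) ℝ).comp (fderiv ℝ (graphNormal f) x)).toLinearMap

/-- The Gaussian curvature of the graph of `f` at `(x, f(x))`: the determinant of the shape
operator. -/
def graphGaussianCurvature {k : ℕ} (f : EuclideanSpace ℝ (Fin k) → ℝ)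
    (x : EuclideanSpace ℝ (Fin k)) : ℝ :=
  LinearMap.det (graphShapeOperator f x)

/-- `|ν̂(ξ)| ≪ |ξ|^{-σ}` for all real `ξ ≠ 0`. -/
def HasFourierDecay (ν : Measure ℝ) (σ : ℝ) : Prop :=
  ∃ C : ℝ, ∀ ξ : ℝ, ξ ≠ 0 → ‖fourierTransform ν ξ‖ ≤ C * |ξ| ^ (-σ)

end FourierDecay

end

/-! Put `r = |ξ| ^ (-(1 + σ) / 2)` and cut `μ` into cylinders of size about `r`. On a cylinder `f`
is affine up to `O(r²)`, so the phase is linear up to `|ξ| r² = |ξ| ^ (-σ)`, and the cylinder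
integral is essentially `μ̂` at `ρ ξ O⁻¹ ∇f(z)`, for any point `z` of the cylinder coming from the
attractor; one averages over `z`. Ratios commute and the rotations are non-expanding, so only `r ^
(-ε)` linear parts `(ρ, O)` occur at this scale. Bounding each cylinder by the sum over all linear
parts and recombining by self-similarity leaves averages `∫ |μ̂(ρ ξ O ∇f(x))| dμ(x)`, to be bounded
uniformly in `ρ ≈ r` and `O` (`exists_norm_fourierTransform_map_le`).

Non-zero curvature makes `∇f` expand distances by a definite factor on finitely many pieces covering
the support. To compare the average with a Lebesgue integral, `μ` is replaced by `m = μ / μ(B(x,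
r))`, whose mass counts `r`-balls. Compact support bounds `|ν̂|` by its averages over balls of
radius `|ξ| ^ ε`. The fibre over such a ball contains about `|ξ| ^ (κ_* σ)` `r`-balls, and all
sample points lie at distance at most about `|ξ| ^ ((1 - σ) / 2)` from the origin. Hence, up to `ε`
losses, `∫ |ν̂| dm ≪ |ξ| ^ (κ_* σ + (k - s)(1 - σ) / 2)`, where `s` is the `l¹` Fourier dimension of
`ν` (`exists_lintegral_fourierTransform_le`).

There are two ways back from `m` to `μ`. Cauchy–Schwarz, with `|ν̂| = |μ̂|²`, brings in the
correlation integral `∫ μ(B(x, r)) dμ ≪ r ^ κ₂`; the Frostman bound, with `ν = μ`, gains `r ^ d_∞`.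
Asking that the outcome beat `|ξ| ^ (-σ)` gives the two thresholds for `σ`. -/

namespace FourierDecay

open scoped FourierTransform SchwartzMap ENNReal

/-! ### Fourier transforms of measures: local averages, small balls, differences. -/

section Fourier

set_option linter.unusedSectionVars false

variable {E : Type*} [NormedAddCommGroup E] [InnerProductSpace ℝ E] [FiniteDimensional ℝ E]
  [MeasurableSpace E] [BorelSpace E]

lemma fourierTransform_eq (μ : Measure E) (ξ : E) :
    fourierTransform μ ξ = ∫ x, ((Real.fourierChar (-(inner ℝ ξ x)) : Circle) : ℂ) ∂μ := by
  unfold fourierTransform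
  congr 1
  ext x
  rw [Real.fourierChar_apply]
  congr 1
  push_cast
  ring

lemma norm_fourierTransform_le_one (μ : Measure E) [IsProbabilityMeasure μ] (ξ : E) :
    ‖fourierTransform μ ξ‖ ≤ 1 := by
  rw [fourierTransform_eq]
  refine (norm_integral_le_integral_norm _).trans (le_of_eq ?_)
  calc _ = ∫ _, (1 : ℝ) ∂μ := integral_congr_ae (.of_forall fun x => Circle.norm_coe _)
    _ = 1 := by simp

lemma continuous_fourierTransform (μ : Measure E) [IsFiniteMeasure μ] :
    Continuous (fourierTransform μ) := by
  have : fourierTransform μ = fun ξ => ∫ x, ((Real.fourierChar (-(inner ℝ ξ x)) : Circle) : ℂ) ∂μ :=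
    funext (fourierTransform_eq μ)
  rw [this]
  refine continuous_of_dominated (bound := fun _ => 1) ?_ ?_ (integrable_const _) ?_
  · intro ξ
    exact (by fun_prop : Continuous fun x => ((Real.fourierChar (-(inner ℝ ξ x)) : Circle) : ℂ)).aestronglyMeasurable
  · intro ξ
    exact .of_forall fun x => (Circle.norm_coe _).le
  · filter_upwards with x
    fun_prop

/-- The multiplication formula for a Schwartz cutoff and the Fourier transform of a measure. -/
lemma integral_schwartz_mul_fourierChar (χ : 𝓢(E, ℂ)) (ν : Measure E) [IsFiniteMeasure ν]
    (a : ℝ) (η : E) :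
    ∫ x, χ (a • x) * ((Real.fourierChar (-(inner ℝ η x)) : Circle) : ℂ) ∂ν
      = ∫ v, (𝓕 χ) v * fourierTransform ν (η - a • v) := by
  have hinv : ∀ y, χ y = ∫ v, ((Real.fourierChar (inner ℝ v y) : Circle) : ℂ) * (𝓕 χ) v := by
    intro y
    have h1 : 𝓕⁻ (𝓕 χ) = χ := FourierTransform.fourierInv_fourier_eq χ
    conv_lhs => rw [← h1]
    rw [SchwartzMap.fourierInv_coe, Real.fourierInv_eq]
    rfl
  have hint : Integrable (Function.uncurry fun (x v : E) =>
      (((Real.fourierChar (inner ℝ v (a • x)) : Circle) : ℂ) * (𝓕 χ) v) *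
        ((Real.fourierChar (-(inner ℝ η x)) : Circle) : ℂ)) (ν.prod volume) := by
    have h2 : Integrable (fun z : E × E => (1 : ℂ) * (𝓕 χ) z.2) (ν.prod volume) :=
      (integrable_const (1 : ℂ)).mul_prod ((𝓕 χ).integrable)
    refine h2.mono ?_ ?_
    · refine Continuous.aestronglyMeasurable ?_
      have := (𝓕 χ).continuous
      unfold Function.uncurry
      fun_prop
    · filter_upwards with z
      simp only [Function.uncurry, norm_mul, one_mul]
      exact le_of_eq (by rw [Circle.norm_coe, Circle.norm_coe, one_mul, mul_one])
  calc ∫ x, χ (a • x) * ((Real.fourierChar (-(inner ℝ η x)) : Circle) : ℂ) ∂ν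
      = ∫ x, (∫ v, (((Real.fourierChar (inner ℝ v (a • x)) : Circle) : ℂ) * (𝓕 χ) v) *
          ((Real.fourierChar (-(inner ℝ η x)) : Circle) : ℂ)) ∂ν := by
        congr 1
        ext x
        rw [integral_mul_const, hinv (a • x)]
    _ = ∫ v, (∫ x, (((Real.fourierChar (inner ℝ v (a • x)) : Circle) : ℂ) * (𝓕 χ) v) *
          ((Real.fourierChar (-(inner ℝ η x)) : Circle) : ℂ) ∂ν) := integral_integral_swap hint
    _ = _ := by
        congr 1
        ext v
        rw [fourierTransform_eq, ← integral_const_mul]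
        congr 1
        ext x
        rw [inner_sub_left, neg_sub, sub_eq_add_neg, AddChar.map_add_eq_mul, inner_smul_left,
          inner_smul_right]
        push_cast
        simp
        ring

/-- Truncation of the multiplication formula, with a rapidly decaying error. -/
lemma exists_norm_integral_schwartz_le (χ : 𝓢(E, ℂ)) (N : ℕ) :
    ∃ C : ℝ, 0 ≤ C ∧ ∀ (ν : Measure E) [IsProbabilityMeasure ν] (a : ℝ) (η : E) (T : ℝ), 0 < T →
      ‖∫ x, χ (a • x) * ((Real.fourierChar (-(inner ℝ η x)) : Circle) : ℂ) ∂ν‖ ≤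
        C * (∫ v in Metric.ball (0 : E) T, ‖fourierTransform ν (η - a • v)‖) + C * (T ^ N)⁻¹ := by
  obtain ⟨C₁, hC₁⟩ : ∃ C, ∀ v, ‖(𝓕 χ) v‖ ≤ C := by
    refine ⟨SchwartzMap.seminorm ℝ 0 0 (𝓕 χ), fun v => ?_⟩
    exact SchwartzMap.norm_le_seminorm ℝ (𝓕 χ) v
  have hI := (𝓕 χ).integrable_pow_mul (volume : Measure E) N
  set C₂ := ∫ v, ‖v‖ ^ N * ‖(𝓕 χ) v‖ with hC₂
  have hC₁0 : 0 ≤ C₁ := (norm_nonneg _).trans (hC₁ 0)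
  have hC₂0 : 0 ≤ C₂ := integral_nonneg fun v => by positivity
  refine ⟨C₁ + C₂, by positivity, ?_⟩
  intro ν _ a η T hT
  have hcont : Continuous fun v => fourierTransform ν (η - a • v) :=
    (continuous_fourierTransform ν).comp (by fun_prop)
  have hint : Integrable fun v => ‖(𝓕 χ) v‖ * ‖fourierTransform ν (η - a • v)‖ := by
    refine (𝓕 χ).integrable.norm.mono
      (((𝓕 χ).continuous.norm.mul hcont.norm).aestronglyMeasurable) ?_
    filter_upwards with v
    simp only [norm_mul, norm_norm]
    exact mul_le_of_le_one_right (norm_nonneg _) (norm_fourierTransform_le_one ν _)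
  rw [integral_schwartz_mul_fourierChar]
  have hsplit : ‖∫ v, (𝓕 χ) v * fourierTransform ν (η - a • v)‖ ≤
      (∫ v in Metric.ball (0 : E) T, ‖(𝓕 χ) v‖ * ‖fourierTransform ν (η - a • v)‖) +
        ∫ v in (Metric.ball (0 : E) T)ᶜ, ‖(𝓕 χ) v‖ * ‖fourierTransform ν (η - a • v)‖ := by
    rw [integral_add_compl measurableSet_ball hint]
    refine (norm_integral_le_integral_norm _).trans (le_of_eq ?_)
    simp
  have h1 : (∫ v in Metric.ball (0 : E) T, ‖(𝓕 χ) v‖ * ‖fourierTransform ν (η - a • v)‖) ≤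
      C₁ * ∫ v in Metric.ball (0 : E) T, ‖fourierTransform ν (η - a • v)‖ := by
    rw [← integral_const_mul]
    refine setIntegral_mono hint.integrableOn ?_ ?_
    · exact ((hcont.norm.const_smul C₁).continuousOn.integrableOn_compact
        (isCompact_closedBall (0 : E) T)).mono_set Metric.ball_subset_closedBall
    · intro v
      exact mul_le_mul_of_nonneg_right (hC₁ v) (norm_nonneg _)
  -- Off the ball the weight `‖v‖ ^ N / T ^ N` is at least one, and `𝓕 χ` has a finite moment of
  -- order `N`.
  have h2 : (∫ v in (Metric.ball (0 : E) T)ᶜ, ‖(𝓕 χ) v‖ * ‖fourierTransform ν (η - a • v)‖) ≤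
      C₂ * (T ^ N)⁻¹ := by
    have h3 : (∫ v in (Metric.ball (0 : E) T)ᶜ, ‖(𝓕 χ) v‖ * ‖fourierTransform ν (η - a • v)‖) ≤
        ∫ v in (Metric.ball (0 : E) T)ᶜ, (‖v‖ ^ N * ‖(𝓕 χ) v‖) * (T ^ N)⁻¹ := by
      refine setIntegral_mono_on hint.integrableOn (hI.mul_const _).integrableOn
        measurableSet_ball.compl ?_
      intro v hv
      have hv' : T ≤ ‖v‖ := by simpa using hv
      have h4 : 1 ≤ ‖v‖ ^ N * (T ^ N)⁻¹ := by
        rw [← div_eq_mul_inv, one_le_div (by positivity)]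
        gcongr
      calc ‖(𝓕 χ) v‖ * ‖fourierTransform ν (η - a • v)‖
          ≤ ‖(𝓕 χ) v‖ * 1 := by
            gcongr
            exact norm_fourierTransform_le_one ν _
        _ ≤ ‖(𝓕 χ) v‖ * (‖v‖ ^ N * (T ^ N)⁻¹) := by gcongr
        _ = _ := by ring
    refine h3.trans ?_
    rw [integral_mul_const]
    gcongr
    exact setIntegral_le_integral hI (Filter.Eventually.of_forall fun v => by positivity)
  have h5 : 0 ≤ ∫ v in Metric.ball (0 : E) T, ‖fourierTransform ν (η - a • v)‖ :=
    integral_nonneg fun v => norm_nonneg _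
  have h6 : 0 ≤ (T ^ N)⁻¹ := by positivity
  nlinarith [mul_nonneg hC₂0 h5, mul_nonneg hC₁0 h6]

/-- A smooth nonnegative cutoff equal to one on a ball. -/
lemma exists_schwartz_cutoff (ρ : ℝ) : ∃ χ : 𝓢(E, ℂ), ∃ g : E → ℝ, (∀ x, χ x = g x) ∧
    (∀ x, 0 ≤ g x) ∧ ∀ x ∈ Metric.closedBall (0 : E) ρ, g x = 1 := by
  let b : ContDiffBump (0 : E) := ⟨max ρ 1, max ρ 1 + 1, by positivity, by linarith⟩
  have hs : HasCompactSupport fun x => ((b x : ℝ) : ℂ) :=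
    b.hasCompactSupport.comp_left (g := fun t : ℝ => (t : ℂ)) (by simp)
  have hd : ContDiff ℝ ((⊤ : ℕ∞) : WithTop ℕ∞) fun x => ((b x : ℝ) : ℂ) :=
    Complex.ofRealCLM.contDiff.comp b.contDiff
  refine ⟨hs.toSchwartzMap hd, b, fun x => rfl, fun x => b.nonneg, fun x hx => ?_⟩
  exact b.one_of_mem_closedBall (Metric.closedBall_subset_closedBall (le_max_left _ _) hx)

/-- The Fourier transform of a measure supported in a fixed ball is essentially dominated by its
local averages. -/
lemma exists_norm_fourierTransform_le (ρ : ℝ) (N : ℕ) :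
    ∃ C : ℝ, 0 ≤ C ∧ ∀ (ν : Measure E) [IsProbabilityMeasure ν],
      (∀ᵐ x ∂ν, x ∈ Metric.closedBall (0 : E) ρ) → ∀ (η : E) (T : ℝ), 0 < T →
      ‖fourierTransform ν η‖ ≤
        C * (∫ ζ in Metric.ball η T, ‖fourierTransform ν ζ‖) + C * (T ^ N)⁻¹ := by
  obtain ⟨χ, g, hχ, -, hg⟩ := exists_schwartz_cutoff (E := E) ρ
  obtain ⟨C, hC, h⟩ := exists_norm_integral_schwartz_le χ N
  refine ⟨C, hC, fun ν _ hν η T hT => ?_⟩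
  -- With scaling `1` the cutoff is one almost everywhere for `ν`, so the left side is exactly the
  -- Fourier transform.
  have h1 := h ν 1 η T hT
  have h2 : ∫ x, χ ((1 : ℝ) • x) * ((Real.fourierChar (-(inner ℝ η x)) : Circle) : ℂ) ∂ν
      = fourierTransform ν η := by
    rw [fourierTransform_eq]
    refine integral_congr_ae ?_
    filter_upwards [hν] with x hx
    simp [hχ, hg x hx]
  have h3 : (∫ v in Metric.ball (0 : E) T, ‖fourierTransform ν (η - (1 : ℝ) • v)‖)
      = ∫ ζ in Metric.ball η T, ‖fourierTransform ν ζ‖ := by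
    rw [← integral_indicator measurableSet_ball, ← integral_indicator measurableSet_ball,
      ← integral_sub_left_eq_self _ volume η]
    congr 1
    ext v
    simp only [Set.indicator, Metric.mem_ball, dist_eq_norm, one_smul]
    rw [sub_zero, sub_sub_cancel, norm_sub_rev]
  rwa [h2, h3] at h1

/-- The mass of a small ball is controlled by the Fourier transform. -/
lemma exists_measure_ball_le (N : ℕ) :
    ∃ C : ℝ, 0 ≤ C ∧ ∀ (ν : Measure E) [IsProbabilityMeasure ν] (r T : ℝ), 0 < r → 0 < T →
      ν.real (Metric.ball 0 r) ≤
        C * (r ^ Module.finrank ℝ E * ∫ ζ in Metric.ball (0 : E) (T / r), ‖fourierTransform ν ζ‖)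
          + C * (T ^ N)⁻¹ := by
  obtain ⟨χ, g, hχ, hg0, hg⟩ := exists_schwartz_cutoff (E := E) 1
  obtain ⟨C, hC, h⟩ := exists_norm_integral_schwartz_le χ N
  refine ⟨C, hC, fun ν _ r T hr hT => ?_⟩
  -- The negative sign turns the sampled frequency `0 - a • v` into `r⁻¹ • v`.
  have h1 := h ν (-r⁻¹) 0 T hT
  have h2 : ν.real (Metric.ball 0 r) ≤
      ‖∫ x, χ ((-r⁻¹) • x) * ((Real.fourierChar (-(inner ℝ (0 : E) x)) : Circle) : ℂ) ∂ν‖ := by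
    have h4 : ∫ x, χ ((-r⁻¹) • x) * ((Real.fourierChar (-(inner ℝ (0 : E) x)) : Circle) : ℂ) ∂ν
        = ((∫ x, g ((-r⁻¹) • x) ∂ν : ℝ) : ℂ) := by
      rw [← integral_complex_ofReal]
      congr 1
      ext x
      simp [hχ]
    have hgi : Integrable (fun x => g ((-r⁻¹) • x)) ν := by
      have : Integrable (fun x => ‖χ ((-r⁻¹) • x)‖) ν := by
        refine Integrable.norm ?_
        refine Integrable.of_bound (C := SchwartzMap.seminorm ℝ 0 0 χ)
          (χ.continuous.comp (by fun_prop)).aestronglyMeasurable ?_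
        filter_upwards with x
        exact SchwartzMap.norm_le_seminorm ℝ χ _
      refine this.congr ?_
      filter_upwards with x
      rw [hχ, Complex.norm_real, Real.norm_of_nonneg (hg0 _)]
    rw [h4, Complex.norm_real, Real.norm_of_nonneg (integral_nonneg fun x => hg0 _),
      ← integral_indicator_one measurableSet_ball]
    refine integral_mono ((integrable_const (1 : ℝ)).indicator measurableSet_ball) hgi ?_
    intro x
    by_cases hx : x ∈ Metric.ball (0 : E) r
    · rw [Set.indicator_of_mem hx]
      change 1 ≤ g ((-r⁻¹) • x)
      rw [hg]
      · simp only [Metric.mem_closedBall, dist_zero_right, norm_smul, norm_neg, norm_inv,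
          Real.norm_of_nonneg hr.le]
        rw [inv_mul_le_one₀ hr]
        simpa using (Metric.mem_ball.1 hx).le
    · rw [Set.indicator_of_notMem hx]
      exact hg0 _
  have h3 : (∫ v in Metric.ball (0 : E) T, ‖fourierTransform ν (0 - (-r⁻¹) • v)‖)
      = r ^ Module.finrank ℝ E * ∫ ζ in Metric.ball (0 : E) (T / r), ‖fourierTransform ν ζ‖ := by
    have h5 := Measure.setIntegral_comp_smul_of_pos (volume : Measure E)
      (fun ζ => ‖fourierTransform ν ζ‖) (Metric.ball (0 : E) T) (inv_pos.2 hr)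
    simp only [neg_smul, sub_neg_eq_add, zero_add]
    rw [h5, smul_ball (inv_pos.2 hr).ne', smul_zero, Real.norm_of_nonneg (inv_pos.2 hr).le]
    simp [div_eq_inv_mul]
  rw [h3] at h1
  exact h2.trans h1

/-- The law of the difference of two independent points distributed according to `μ`. -/
noncomputable def diffMeasure (μ : Measure E) : Measure E := (μ.prod μ).map fun p => p.1 - p.2

instance (μ : Measure E) [IsProbabilityMeasure μ] : IsProbabilityMeasure (diffMeasure μ) :=
  Measure.isProbabilityMeasure_map (by fun_prop)

/-- Differences turn convolution into `μ̂` times its conjugate. Thus `l²` information on `μ` is `l¹`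
information on `diffMeasure μ`, and one `l¹` argument serves both `κ₁` and `κ₂`. -/
lemma norm_fourierTransform_diffMeasure (μ : Measure E) [IsProbabilityMeasure μ] (ξ : E) :
    ‖fourierTransform (diffMeasure μ) ξ‖ = ‖fourierTransform μ ξ‖ ^ 2 := by
  have h : fourierTransform (diffMeasure μ) ξ
      = fourierTransform μ ξ * (starRingEnd ℂ) (fourierTransform μ ξ) := by
    rw [fourierTransform_eq, fourierTransform_eq, ← integral_conj, ← integral_prod_mul, diffMeasure,
      integral_map (by fun_prop)
        (by fun_prop : Continuous fun x => ((Real.fourierChar (-(inner ℝ ξ x)) : Circle) : ℂ)).aestronglyMeasurable]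
    congr 1
    ext p
    rw [inner_sub_right, neg_sub, sub_eq_add_neg, AddChar.map_add_eq_mul, AddChar.map_neg_eq_inv, AddChar.map_neg_eq_inv]
    rw [← Circle.coe_inv_eq_conj, inv_inv, ← Circle.coe_mul, mul_comm]
  rw [h, norm_mul, RCLike.norm_conj, sq]

lemma diffMeasure_ball (μ : Measure E) [IsProbabilityMeasure μ] (r : ℝ) :
    diffMeasure μ (Metric.ball 0 r) = ∫⁻ x, μ (Metric.ball x r) ∂μ := by
  rw [diffMeasure, Measure.map_apply (by fun_prop) measurableSet_ball,
    Measure.prod_apply (measurableSet_ball.preimage (by fun_prop))]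
  congr 1
  ext x
  congr 1
  ext y
  simp [dist_eq_norm, norm_sub_rev]

lemma diffMeasure_support (μ : Measure E) [IsProbabilityMeasure μ] {ρ : ℝ}
    (h : ∀ᵐ x ∂μ, x ∈ Metric.closedBall (0 : E) ρ) :
    ∀ᵐ x ∂(diffMeasure μ), x ∈ Metric.closedBall (0 : E) (2 * ρ) := by
  refine (ae_map_iff (by fun_prop) (p := fun x => x ∈ Metric.closedBall (0 : E) (2 * ρ))
    measurableSet_closedBall).2 ?_
  filter_upwards [Measure.quasiMeasurePreserving_fst.ae h,
    Measure.quasiMeasurePreserving_snd.ae h] with p h1 h2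
  simp only [Metric.mem_closedBall, dist_zero_right] at *
  linarith [norm_sub_le p.1 p.2]

end Fourier

/-! ### Coverings and the exponents extracted from the dimensions. -/

section Dimension

variable {k : ℕ}

/-- If `x` lies in a ball of radius `r / 2`, then `ball x r` contains that ball, so each covering
ball contributes at most one, even when it is null. -/
lemma setLIntegral_inv_measure_ball_le {X : Type*} [PseudoMetricSpace X] [MeasurableSpace X]
    [OpensMeasurableSpace X] (μ : Measure X) [IsFiniteMeasure μ] {r : ℝ} {A : Set X} {t : Finset X}
    (hA : A ⊆ ⋃ y ∈ t, Metric.ball y (r / 2)) :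
    ∫⁻ x in A, (μ (Metric.ball x r))⁻¹ ∂μ ≤ t.card := by
  have h1 : ∀ y, ∫⁻ x in Metric.ball y (r / 2), (μ (Metric.ball x r))⁻¹ ∂μ ≤ 1 := by
    intro y
    calc ∫⁻ x in Metric.ball y (r / 2), (μ (Metric.ball x r))⁻¹ ∂μ
        ≤ ∫⁻ _ in Metric.ball y (r / 2), (μ (Metric.ball y (r / 2)))⁻¹ ∂μ := by
          refine setLIntegral_mono measurable_const fun x hx => ?_
          refine ENNReal.inv_le_inv.2 (measure_mono fun z hz => ?_)
          rw [Metric.mem_ball] at *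
          linarith [dist_triangle_right z x y]
      _ = (μ (Metric.ball y (r / 2)))⁻¹ * μ (Metric.ball y (r / 2)) := by
          rw [setLIntegral_const]
      _ ≤ 1 := ENNReal.inv_mul_le_one _
  have h2 : ∀ s : Finset X, ∫⁻ x in ⋃ y ∈ s, Metric.ball y (r / 2), (μ (Metric.ball x r))⁻¹ ∂μ
      ≤ s.card := by
    classical
    intro s
    induction s using Finset.induction_on with
    | empty => simp
    | insert a s ha ih =>
      rw [Finset.set_biUnion_insert, Finset.card_insert_of_notMem ha]
      refine (lintegral_union_le _ _ _).trans ?_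
      push_cast
      rw [add_comm]
      exact add_le_add ih (h1 a)
  exact (lintegral_mono_set hA).trans (h2 t)

lemma measurable_measure_ball {X : Type*} [PseudoMetricSpace X] [MeasurableSpace X] [BorelSpace X]
    [SecondCountableTopology X] (μ : Measure X) [SFinite μ] (r : ℝ) :
    Measurable fun x => μ (Metric.ball x r) := by
  have h : MeasurableSet {p : X × X | dist p.2 p.1 < r} :=
    (isOpen_lt (by fun_prop) continuous_const).measurableSet
  exact measurable_measure_prodMk_left h

lemma exists_iterated_cover (F : Type*) [NormedAddCommGroup F] [NormedSpace ℝ F]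
    [FiniteDimensional ℝ F] :
    ∃ m : ℕ, 1 ≤ m ∧ ∀ (j : ℕ) (x : F) (R : ℝ), 0 < R →
      ∃ t : Finset F, t.card ≤ m ^ j ∧ Metric.ball x R ⊆ ⋃ y ∈ t, Metric.ball y (R / 2 ^ j) := by
  classical
  have := FiniteDimensional.proper_real F
  obtain ⟨t₀, -, hfin, ht₀⟩ := (isCompact_closedBall (0 : F) 1).finite_cover_balls
    (by norm_num : (0 : ℝ) < 1 / 2)
  set s := hfin.toFinset with hs
  have hs' : Metric.closedBall (0 : F) 1 ⊆ ⋃ y ∈ s, Metric.ball y (1 / 2) := by simpa [hs] using ht₀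
  have hone : ∀ (x : F) (R : ℝ), 0 < R →
      Metric.ball x R ⊆ ⋃ y ∈ s.image (fun z => x + R • z), Metric.ball y (R / 2) := by
    intro x R hR y hy
    have h1 : R⁻¹ • (y - x) ∈ Metric.closedBall (0 : F) 1 := by
      rw [mem_closedBall_zero_iff, norm_smul, norm_inv, Real.norm_of_nonneg hR.le,
        inv_mul_le_one₀ hR, ← dist_eq_norm]
      exact (Metric.mem_ball.1 hy).le
    obtain ⟨z, hz, hz'⟩ := Set.mem_iUnion₂.1 (hs' h1)
    refine Set.mem_iUnion₂.2 ⟨x + R • z, Finset.mem_image_of_mem _ hz, ?_⟩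
    rw [Metric.mem_ball, dist_eq_norm] at *
    have : y - (x + R • z) = R • (R⁻¹ • (y - x) - z) := by
      rw [smul_sub, smul_inv_smul₀ hR.ne']
      abel
    rw [this, norm_smul, Real.norm_of_nonneg hR.le]
    nlinarith
  refine ⟨s.card, ?_, ?_⟩
  · rw [Nat.one_le_iff_ne_zero, Finset.card_ne_zero]
    obtain ⟨z, hz, -⟩ := Set.mem_iUnion₂.1 (hs' (Metric.mem_closedBall_self zero_le_one))
    exact ⟨z, hz⟩
  · intro j
    induction j with
    | zero => intro x R _; exact ⟨{x}, by simp, by simp⟩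
    | succ j ih =>
      intro x R hR
      choose T hT hT' using fun y => ih y (R / 2) (by positivity)
      refine ⟨(s.image (fun z => x + R • z)).biUnion T, ?_, ?_⟩
      · refine (Finset.card_biUnion_le_card_mul (s.image (fun z => x + R • z)) T (s.card ^ j)
          fun y _ => hT y).trans ?_
        rw [pow_succ']
        exact Nat.mul_le_mul_right _ Finset.card_image_le
      · intro z hz
        obtain ⟨y, hy, hyz⟩ := Set.mem_iUnion₂.1 (hone x R hR hz)
        obtain ⟨w, hw, hwz⟩ := Set.mem_iUnion₂.1 (hT' y hyz)
        refine Set.mem_iUnion₂.2 ⟨w, Finset.mem_biUnion.2 ⟨y, hy, hw⟩, ?_⟩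
        rwa [pow_succ', ← div_div]

/-- Doubling of a finite-dimensional space. It makes the set defining `assouadDim` nonempty and the
covering numbers attained, so neither `sInf` takes its default value. -/
lemma exists_cover_card_le (F : Type*) [NormedAddCommGroup F] [NormedSpace ℝ F]
    [FiniteDimensional ℝ F] :
    ∃ α C : ℝ, 0 ≤ α ∧ 0 < C ∧ ∀ (r R : ℝ), 0 < r → r < R → ∀ x : F,
      ∃ t : Finset F, (t.card : ℝ) ≤ C * (R / r) ^ α ∧
        Metric.ball x R ⊆ ⋃ y ∈ t, Metric.ball y (r / 2) := by
  obtain ⟨m, hm, h⟩ := exists_iterated_cover F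
  have hm' : (1 : ℝ) ≤ m := by exact_mod_cast hm
  have hα : 0 ≤ Real.logb 2 m := Real.logb_nonneg (by norm_num) hm'
  refine ⟨Real.logb 2 m, m * 2 ^ Real.logb 2 m, hα, by positivity, ?_⟩
  intro r R hr hrR x
  have hR : 0 < R := hr.trans hrR
  have hq : 1 ≤ 2 * R / r := by
    rw [one_le_div hr]
    linarith
  -- Target radius `r / 2` requires `log₂ (2R / r)` halvings; the ceiling costs the factor `m`, and
  -- the `2` in `2R / r` costs `2 ^ logb 2 m`.
  obtain ⟨t, ht, hcov⟩ := h ⌈Real.logb 2 (2 * R / r)⌉₊ x R hR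
  refine ⟨t, ?_, hcov.trans ?_⟩
  · calc (t.card : ℝ) ≤ (m : ℝ) ^ ⌈Real.logb 2 (2 * R / r)⌉₊ := by exact_mod_cast ht
      _ = (m : ℝ) ^ ((⌈Real.logb 2 (2 * R / r)⌉₊ : ℕ) : ℝ) := by rw [Real.rpow_natCast]
      _ ≤ (m : ℝ) ^ (Real.logb 2 (2 * R / r) + 1) := by
          gcongr
          exact (Nat.ceil_lt_add_one (Real.logb_nonneg (by norm_num) hq)).le
      _ = m * (2 * R / r) ^ Real.logb 2 m := by
          rw [Real.rpow_add (by positivity), Real.rpow_one, mul_comm]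
          congr 1
          rw [Real.rpow_def_of_pos (by positivity), Real.rpow_def_of_pos (by positivity)]
          congr 1
          simp only [Real.logb]
          ring
      _ = _ := by
          rw [mul_div_assoc, Real.mul_rpow (by norm_num) (by positivity)]
          ring
  · refine Set.iUnion₂_mono fun y _ => Metric.ball_subset_ball ?_
    rw [div_le_div_iff₀ (by positivity) (by norm_num)]
    have : 2 * R / r ≤ 2 ^ ⌈Real.logb 2 (2 * R / r)⌉₊ := by
      rw [← Real.rpow_natCast]
      conv_lhs => rw [← Real.rpow_logb (by norm_num : (0 : ℝ) < 2) (by norm_num)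
        (by positivity : 0 < 2 * R / r)]
      gcongr
      · norm_num
      · exact Nat.le_ceil _
    rw [div_le_iff₀ hr] at this
    linarith

/-- Coverings realizing any exponent above the Assouad dimension. -/
lemma exists_cover_of_assouadDim_lt {A : Set (EuclideanSpace ℝ (Fin k))} {α : ℝ}
    (hα : assouadDim A < α) :
    0 < α ∧ ∃ C : ℝ, 0 < C ∧ ∀ r R : ℝ, 0 < r → r < R → ∀ x ∈ A,
      ∃ t : Finset (EuclideanSpace ℝ (Fin k)), (t.card : ℝ) ≤ C * (R / r) ^ α ∧
        Metric.ball x R ∩ A ⊆ ⋃ y ∈ t, Metric.ball y (r / 2) := by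
  obtain ⟨α₀, C₀, hα₀, hC₀, hcov⟩ := exists_cover_card_le (EuclideanSpace ℝ (Fin k))
  have hmem : Set.Nonempty {α : ℝ | 0 ≤ α ∧ ∃ C : ℝ, 0 < C ∧ ∀ r R : ℝ, 0 < r → r < R →
      ∀ x ∈ A, (ballCoveringNumber r (Metric.ball x R ∩ A) : ℝ) ≤ C * (R / r) ^ α} := by
    refine ⟨α₀, hα₀, C₀, hC₀, fun r R hr hrR x _ => ?_⟩
    obtain ⟨t, ht, hsub⟩ := hcov r R hr hrR x
    have : ballCoveringNumber r (Metric.ball x R ∩ A) ≤ t.card :=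
      Nat.sInf_le ⟨t, rfl, Set.inter_subset_left.trans hsub⟩
    exact (Nat.cast_le.2 this).trans ht
  obtain ⟨β, ⟨hβ, C, hC, h⟩, hβα⟩ := exists_lt_of_csInf_lt hmem hα
  refine ⟨hβ.trans_lt hβα, C, hC, fun r R hr hrR x hx => ?_⟩
  have hne : {m : ℕ | ∃ t : Finset (EuclideanSpace ℝ (Fin k)), t.card = m ∧
      Metric.ball x R ∩ A ⊆ ⋃ y ∈ t, Metric.ball y (r / 2)}.Nonempty := by
    obtain ⟨t, -, hsub⟩ := hcov r R hr hrR x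
    exact ⟨t.card, t, rfl, Set.inter_subset_left.trans hsub⟩
  obtain ⟨t, ht, hsub⟩ := Nat.sInf_mem hne
  refine ⟨t, ?_, hsub⟩
  rw [ht]
  refine (h r R hr hrR x hx).trans ?_
  gcongr
  rw [one_le_div hr]
  exact hrR.le

/-- The exponent `0` is admissible because `|μ̂| ≤ 1`, so the supremum is over a nonempty set.
Restricting to `R ≥ 1` allows an admissible `s' > s` to be lowered to `s`. -/
lemma exists_integral_le_of_lt_fourierDim (hk : 1 ≤ k) {p s : ℝ} (hp : 0 ≤ p)
    (μ : Measure (EuclideanSpace ℝ (Fin k))) [IsProbabilityMeasure μ]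
    (hs : s < fourierDim p μ) :
    ∃ C : ℝ, 0 ≤ C ∧ ∀ R : ℝ, 1 ≤ R →
      ∫ ξ in Metric.ball (0 : EuclideanSpace ℝ (Fin k)) R, ‖fourierTransform μ ξ‖ ^ p
        ≤ C * R ^ ((k : ℝ) - s) := by
  obtain ⟨s', ⟨hs'0, hs'k, C, hC⟩, hss'⟩ := exists_lt_of_lt_csSup (by
    refine ⟨0, le_rfl, by exact_mod_cast hk,
      volume.real (Metric.ball (0 : EuclideanSpace ℝ (Fin k)) 1), fun R hR => ?_⟩
    calc ∫ ξ in Metric.ball (0 : EuclideanSpace ℝ (Fin k)) R, ‖fourierTransform μ ξ‖ ^ p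
        ≤ ∫ ξ in Metric.ball (0 : EuclideanSpace ℝ (Fin k)) R, (1 : ℝ) := by
          refine integral_mono_of_nonneg (.of_forall fun ξ => by positivity) ?_
            (.of_forall fun ξ => ?_)
          · exact integrableOn_const (by finiteness)
          · exact Real.rpow_le_one (norm_nonneg _) (norm_fourierTransform_le_one μ ξ) hp
      _ = volume.real (Metric.ball (0 : EuclideanSpace ℝ (Fin k)) 1) * R ^ ((k : ℝ) - 0) := by
          rw [setIntegral_const, Measure.real, Measure.addHaar_ball_of_pos _ _ hR,
            ENNReal.toReal_mul, ENNReal.toReal_ofReal (by positivity), finrank_euclideanSpace_fin,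
            sub_zero, Real.rpow_natCast, smul_eq_mul, mul_one, mul_comm]
          rfl) hs
  refine ⟨|C|, abs_nonneg C, fun R hR => (hC R (by linarith)).trans ?_⟩
  gcongr
  exact le_abs_self C

lemma exists_measure_ball_le_of_lt_frostmanExponent {s : ℝ}
    (μ : Measure (EuclideanSpace ℝ (Fin k))) [IsProbabilityMeasure μ]
    (hs : s < frostmanExponent μ) :
    ∃ C : ℝ, 0 ≤ C ∧ ∀ (x : EuclideanSpace ℝ (Fin k)) (r : ℝ), 0 < r → r ≤ 1 →
      μ.real (Metric.ball x r) ≤ C * r ^ s := by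
  obtain ⟨s', ⟨hs'0, C, hC⟩, hss'⟩ := exists_lt_of_lt_csSup (by
    refine ⟨0, le_rfl, 1, fun x r _ => ?_⟩
    simp) hs
  refine ⟨|C|, abs_nonneg C, fun x r hr hr1 => (hC x r hr).trans ?_⟩
  have := Real.rpow_le_rpow_of_exponent_ge hr hr1 hss'.le
  have h0 : 0 ≤ r ^ s' := by positivity
  calc C * r ^ s' ≤ |C| * r ^ s' := by gcongr; exact le_abs_self C
    _ ≤ _ := by gcongr

end Dimension

/-! ### Curvature, expansion of the gradient map, and Taylor's formula. -/

section Geometry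

variable {k : ℕ}

lemma contDiff_gradient {f : EuclideanSpace ℝ (Fin k) → ℝ} (hf : ContDiff ℝ 2 f) :
    ContDiff ℝ 1 (gradient f) := by
  have h : ContDiff ℝ 1 (fderiv ℝ f) := hf.fderiv_right (by norm_num)
  exact (InnerProductSpace.toDual ℝ (EuclideanSpace ℝ (Fin k))).symm.contDiff.comp h

/-- The unit normal is a smooth function of the gradient, so by the chain rule the shape operator
factors through the derivative of `gradient f`; if the former is invertible, the latter is
injective. -/
lemma injective_fderiv_gradient_of_curvature_ne_zero {f : EuclideanSpace ℝ (Fin k) → ℝ}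
    (hf : ContDiff ℝ 2 f) {x : EuclideanSpace ℝ (Fin k)} (hx : graphGaussianCurvature f x ≠ 0) :
    Function.Injective (fderiv ℝ (gradient f) x) := by
  set G : EuclideanSpace ℝ (Fin k) → WithLp 2 (EuclideanSpace ℝ (Fin k) × ℝ) := fun p =>
    (Real.sqrt (1 + ‖p‖ ^ 2))⁻¹ • WithLp.toLp 2 (-p, (1 : ℝ)) with hG
  have hGd : DifferentiableAt ℝ G (gradient f x) := by
    refine DifferentiableAt.smul (DifferentiableAt.inv (DifferentiableAt.sqrt ?_ ?_) ?_) ?_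
    · exact (differentiableAt_const _).add (differentiable_id.norm_sq ℝ _)
    · positivity
    · positivity
    · refine (WithLp.prodContinuousLinearEquiv 2 ℝ (EuclideanSpace ℝ (Fin k))
        ℝ).symm.differentiableAt.comp _ (f := fun p : EuclideanSpace ℝ (Fin k) => (-p, (1 : ℝ))) ?_
      fun_prop
  have hgd : DifferentiableAt ℝ (gradient f) x :=
    (contDiff_gradient hf).differentiable one_ne_zero x
  have hcomp : fderiv ℝ (graphNormal f) x
      = (fderiv ℝ G (gradient f x)).comp (fderiv ℝ (gradient f) x) :=
    fderiv_comp x hGd hgd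
  have hinj : Function.Injective (graphShapeOperator f x) := by
    have h := LinearMap.isUnit_iff_isUnit_det (graphShapeOperator f x) |>.2
      (isUnit_iff_ne_zero.2 hx)
    exact ((Module.End.isUnit_iff _).1 h).1
  intro v w hvw
  apply hinj
  simp only [graphShapeOperator, hcomp, ContinuousLinearMap.coe_coe,
    ContinuousLinearMap.comp_apply, hvw]

/-- `φ` expands distances on `S` by a factor at least `c`. -/
def LowerLipschitzOn {F : Type*} [NormedAddCommGroup F] (c : ℝ) (φ : F → F) (S : Set F) : Prop :=
  ∀ x ∈ S, ∀ y ∈ S, c * ‖x - y‖ ≤ ‖φ x - φ y‖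

/-- An injective linear map is bounded below by `K⁻¹`, and strict differentiability makes the
nonlinear error at most half of this near `x`. -/
lemma exists_lowerLipschitzOn_nhds {F : Type*} [NormedAddCommGroup F] [NormedSpace ℝ F]
    [FiniteDimensional ℝ F] {φ : F → F} (hφ : ContDiff ℝ 1 φ) {x : F}
    (hx : Function.Injective (fderiv ℝ φ x)) :
    ∃ c : ℝ, 0 < c ∧ ∃ S ∈ nhds x, LowerLipschitzOn c φ S := by
  obtain ⟨K, hK, hA⟩ := (fderiv ℝ φ x).toLinearMap.exists_antilipschitzWith
    (LinearMap.ker_eq_bot.2 hx)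
  have hK' : (0 : ℝ) < K := hK
  have hs : HasStrictFDerivAt φ (fderiv ℝ φ x) x :=
    hφ.contDiffAt.hasStrictFDerivAt one_ne_zero
  have h1 := hs.isLittleO.def (c := (K : ℝ)⁻¹ / 2) (by positivity)
  rw [nhds_prod_eq] at h1
  obtain ⟨S, hS, hS'⟩ := (Filter.eventually_prod_self_iff (r := fun y z =>
    ‖φ y - φ z - fderiv ℝ φ x (y - z)‖ ≤ (K : ℝ)⁻¹ / 2 * ‖y - z‖)).1 h1
  refine ⟨(K : ℝ)⁻¹ / 2, by positivity, S, hS, fun y hy z hz => ?_⟩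
  have h2 := hS' y hy z hz
  have h3 : ‖y - z‖ ≤ K * ‖fderiv ℝ φ x (y - z)‖ := by
    have := hA.le_mul_dist y z
    rw [dist_eq_norm, dist_eq_norm, ← map_sub] at this
    exact this
  have h4 : (K : ℝ)⁻¹ * ‖y - z‖ ≤ ‖fderiv ℝ φ x (y - z)‖ := by
    rw [inv_mul_le_iff₀ hK']
    exact h3
  have h5 := norm_sub_norm_le (fderiv ℝ φ x (y - z)) (φ y - φ z)
  rw [norm_sub_rev (φ y - φ z)] at h2
  linarith

lemma exists_finite_cover_lowerLipschitzOn {F : Type*} [NormedAddCommGroup F] [NormedSpace ℝ F]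
    [FiniteDimensional ℝ F] {φ : F → F} (hφ : ContDiff ℝ 1 φ) {X : Set F} (hX : IsCompact X)
    (h : ∀ x ∈ X, Function.Injective (fderiv ℝ φ x)) :
    ∃ (c : ℝ) (𝒮 : Finset (Set F)), 0 < c ∧ X ⊆ ⋃ S ∈ 𝒮, S ∧ ∀ S ∈ 𝒮, LowerLipschitzOn c φ S := by
  classical
  refine hX.induction_on (p := fun X => ∃ (c : ℝ) (𝒮 : Finset (Set F)), 0 < c ∧ X ⊆ ⋃ S ∈ 𝒮, S ∧
    ∀ S ∈ 𝒮, LowerLipschitzOn c φ S) ?_ ?_ ?_ ?_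
  · exact ⟨1, ∅, one_pos, by simp, by simp⟩
  · rintro s t hst ⟨c, 𝒮, hc, hcov, hS⟩
    exact ⟨c, 𝒮, hc, hst.trans hcov, hS⟩
  · rintro s t ⟨c, 𝒮, hc, hcov, hS⟩ ⟨d, 𝒯, hd, hcov', hT⟩
    refine ⟨min c d, 𝒮 ∪ 𝒯, lt_min hc hd, ?_, ?_⟩
    · rw [Finset.set_biUnion_union]
      exact Set.union_subset_union hcov hcov'
    · intro S hS' x hx y hy
      rcases Finset.mem_union.1 hS' with h | h
      · exact (mul_le_mul_of_nonneg_right (min_le_left _ _) (norm_nonneg _)).trans (hS S h x hx y hy)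
      · exact (mul_le_mul_of_nonneg_right (min_le_right _ _) (norm_nonneg _)).trans (hT S h x hx y hy)
  · intro x hx
    obtain ⟨c, hc, S, hS, hS'⟩ := exists_lowerLipschitzOn_nhds hφ (h x hx)
    exact ⟨S, mem_nhdsWithin_of_mem_nhds hS, c, {S}, hc, by simp, by simpa using hS'⟩

lemma exists_taylor_bound {f : EuclideanSpace ℝ (Fin k) → ℝ} (hf : ContDiff ℝ 2 f)
    {K : Set (EuclideanSpace ℝ (Fin k))} (hK : IsCompact K) :
    ∃ C : ℝ, 0 ≤ C ∧ ∀ x ∈ K, ∀ y ∈ K,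
      |f y - f x - inner ℝ (gradient f x) (y - x)| ≤ C * ‖y - x‖ ^ 2 := by
  obtain ⟨ρ, hρ⟩ := hK.isBounded.subset_closedBall (0 : EuclideanSpace ℝ (Fin k))
  have hf1 : ContDiff ℝ 1 (fderiv ℝ f) := hf.fderiv_right (by norm_num)
  obtain ⟨C, hC⟩ := (isCompact_closedBall (0 : EuclideanSpace ℝ (Fin k)) ρ).exists_bound_of_continuousOn
    (hf1.continuous_fderiv one_ne_zero).continuousOn
  refine ⟨|C|, abs_nonneg C, fun x hx y hy => ?_⟩
  -- `K` need not be convex, so the second derivative is bounded on a ball containing `K`, where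
  -- segments stay.
  have hconv := convex_closedBall (0 : EuclideanSpace ℝ (Fin k)) ρ
  have hseg : segment ℝ x y ⊆ Metric.closedBall 0 ρ := hconv.segment_subset (hρ hx) (hρ hy)
  have hd : ∀ z ∈ segment ℝ x y, ‖fderiv ℝ f z - fderiv ℝ f x‖ ≤ |C| * ‖y - x‖ := by
    intro z hz
    have h1 := hconv.norm_image_sub_le_of_norm_fderiv_le (𝕜 := ℝ) (f := fderiv ℝ f)
      (fun w _ => hf1.differentiable one_ne_zero w) (fun w hw => (hC w hw).trans (le_abs_self C))
      (hρ hx) (hseg hz)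
    refine h1.trans ?_
    gcongr
    have := mem_segment_iff_wbtw.1 hz |>.dist_add_dist
    rw [← dist_eq_norm, ← dist_eq_norm, dist_comm z x, dist_comm y x]
    linarith [dist_nonneg (x := z) (y := y)]
  have h2 := (convex_segment x y).norm_image_sub_le_of_norm_hasFDerivWithin_le'
    (f := f) (φ := fderiv ℝ f x) (f' := fderiv ℝ f)
    (fun z _ => (hf.differentiable two_ne_zero z).hasFDerivAt.hasFDerivWithinAt) hd
    (left_mem_segment ℝ x y) (right_mem_segment ℝ x y)
  have h3 : inner ℝ (gradient f x) (y - x) = fderiv ℝ f x (y - x) := by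
    rw [gradient, InnerProductSpace.toDual_symm_apply]
  rw [h3, ← Real.norm_eq_abs]
  refine h2.trans (le_of_eq ?_)
  ring

end Geometry

lemma norm_fourierChar_sub_le (a b : ℝ) :
    ‖((Real.fourierChar a : Circle) : ℂ) - ((Real.fourierChar b : Circle) : ℂ)‖
      ≤ 2 * Real.pi * |a - b| := by
  have h : ((Real.fourierChar a : Circle) : ℂ) = ((Real.fourierChar b : Circle) : ℂ) *
      ((Real.fourierChar (a - b) : Circle) : ℂ) := by
    rw [← Circle.coe_mul, ← AddChar.map_add_eq_mul, add_sub_cancel]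
  have h2 : ((Real.fourierChar (a - b) : Circle) : ℂ)
      = Complex.exp (Complex.I * ((2 * Real.pi * (a - b) : ℝ) : ℂ)) := by
    rw [Real.fourierChar_apply, mul_comm]
  rw [h, ← mul_sub_one, norm_mul, Circle.norm_coe, one_mul, h2]
  refine (Real.norm_exp_I_mul_ofReal_sub_one_le).trans (le_of_eq ?_)
  rw [Real.norm_eq_abs, abs_mul, abs_of_pos Real.two_pi_pos]

/-! ### Words, linear parts at a given scale, and linearization on cylinders. -/

namespace SelfSimilarIFS

variable {k : ℕ} (Λ : SelfSimilarIFS k)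

/-- The contraction ratio of the similarity coded by a word. -/
def wordRatio (w : List (Fin Λ.N)) : ℝ := (w.map Λ.ratio).prod

/-- The orthogonal part of the similarity coded by a word. -/
noncomputable def wordRot (w : List (Fin Λ.N)) : EuclideanSpace ℝ (Fin k) ≃ₗᵢ[ℝ] EuclideanSpace ℝ (Fin k) :=
  (w.map Λ.rot).prod

/-- The similarity coded by a word. -/
noncomputable def wordMap (w : List (Fin Λ.N)) (x : EuclideanSpace ℝ (Fin k)) : EuclideanSpace ℝ (Fin k) :=
  w.foldr Λ.map x

lemma wordRatio_append (w : List (Fin Λ.N)) (i : Fin Λ.N) :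
    Λ.wordRatio (w ++ [i]) = Λ.wordRatio w * Λ.ratio i := by
  simp [wordRatio]

lemma wordMap_append (w : List (Fin Λ.N)) (i : Fin Λ.N) (x : EuclideanSpace ℝ (Fin k)) :
    Λ.wordMap (w ++ [i]) x = Λ.wordMap w (Λ.map i x) := by
  simp [wordMap]

lemma wordRatio_pos (w : List (Fin Λ.N)) : 0 < Λ.wordRatio w := by
  refine List.prod_pos fun a ha => ?_
  obtain ⟨i, -, rfl⟩ := List.mem_map.1 ha
  exact Λ.ratio_pos i

lemma wordMap_sub (w : List (Fin Λ.N)) (x y : EuclideanSpace ℝ (Fin k)) :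
    Λ.wordMap w x - Λ.wordMap w y = Λ.wordRatio w • Λ.wordRot w (x - y) := by
  induction w with
  | nil => simp [wordMap, wordRatio, wordRot]
  | cons i w ih =>
    have h : Λ.wordMap (i :: w) x - Λ.wordMap (i :: w) y
        = Λ.ratio i • Λ.rot i (Λ.wordMap w x - Λ.wordMap w y) := by
      simp only [wordMap, List.foldr_cons, map, map_sub, smul_sub]
      abel
    rw [h, ih]
    simp [wordRatio, wordRot, mul_smul]

lemma continuous_map (i : Fin Λ.N) : Continuous (Λ.map i) := by
  unfold map
  have := (Λ.rot i).continuous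
  fun_prop

lemma continuous_wordMap (w : List (Fin Λ.N)) : Continuous (Λ.wordMap w) := by
  induction w with
  | nil => exact continuous_id
  | cons i w ih => exact (Λ.continuous_map i).comp ih

lemma wordMap_mem {K : Set (EuclideanSpace ℝ (Fin k))} (hK : ∀ i, ∀ x ∈ K, Λ.map i x ∈ K)
    (w : List (Fin Λ.N)) {x : EuclideanSpace ℝ (Fin k)} (hx : x ∈ K) : Λ.wordMap w x ∈ K := by
  induction w with
  | nil => exact hx
  | cons i w ih => exact hK i _ ih

lemma exists_ratio_bounds :
    ∃ c d : ℝ, 0 < c ∧ c < 1 ∧ 0 < d ∧ d < 1 ∧ ∀ i, c ≤ Λ.ratio i ∧ Λ.ratio i ≤ d := by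
  have : Nonempty (Fin Λ.N) := ⟨⟨0, by have := Λ.one_lt_N; omega⟩⟩
  obtain ⟨i, hi⟩ := Finite.exists_min Λ.ratio
  obtain ⟨j, hj⟩ := Finite.exists_max Λ.ratio
  exact ⟨Λ.ratio i, Λ.ratio j, Λ.ratio_pos i, Λ.ratio_lt_one i, Λ.ratio_pos j, Λ.ratio_lt_one j,
    fun l => ⟨hi l, hj l⟩⟩

lemma wordRatio_le_pow {d : ℝ} (hd : ∀ i, Λ.ratio i ≤ d) (w : List (Fin Λ.N)) :
    Λ.wordRatio w ≤ d ^ w.length := by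
  induction w with
  | nil => simp [wordRatio]
  | cons i w ih =>
    have h : Λ.wordRatio (i :: w) = Λ.ratio i * Λ.wordRatio w := by simp [wordRatio]
    rw [h, List.length_cons, pow_succ']
    exact mul_le_mul (hd i) ih (Λ.wordRatio_pos w).le ((Λ.ratio_pos i).le.trans (hd i))

lemma wordRot_mem (w : List (Fin Λ.N)) : Λ.wordRot w ∈ Set.range Λ.rot ^ w.length := by
  induction w with
  | nil => simp [wordRot]
  | cons i w ih =>
    have h : Λ.wordRot (i :: w) = Λ.rot i * Λ.wordRot w := by simp [wordRot]
    rw [h, List.length_cons, pow_succ']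
    exact Set.mul_mem_mul ⟨i, rfl⟩ ih

/-- Ratios commute, so only letter counts matter: words of length `n` yield polynomially many
ratios. -/
lemma wordRatio_eq_prod_count (w : List (Fin Λ.N)) :
    Λ.wordRatio w = ∏ i, Λ.ratio i ^ w.count i := by
  rw [wordRatio, Finset.prod_list_map_count]
  refine Finset.prod_subset (Finset.subset_univ _) fun i _ hi => ?_
  rw [List.count_eq_zero.2 (by simpa using hi), pow_zero]

/-- The linear parts of the similarities coded by words of length `n`. -/
def linearParts (n : ℕ) :
    Set (ℝ × (EuclideanSpace ℝ (Fin k) ≃ₗᵢ[ℝ] EuclideanSpace ℝ (Fin k))) :=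
  {p | ∃ w : List (Fin Λ.N), w.length = n ∧ p = (Λ.wordRatio w, Λ.wordRot w)}

lemma linearParts_subset (n : ℕ) : Λ.linearParts n ⊆
    (Set.range fun a : Fin Λ.N → Fin (n + 1) => ∏ i, Λ.ratio i ^ (a i : ℕ)) ×ˢ
      (Set.range Λ.rot ^ n) := by
  rintro p ⟨w, hw, rfl⟩
  refine ⟨⟨fun i => ⟨w.count i, ?_⟩, ?_⟩, ?_⟩
  · have := w.count_le_length (a := i)
    omega
  · exact (Λ.wordRatio_eq_prod_count w).symm
  · rw [← hw]
    exact Λ.wordRot_mem w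

lemma finite_range_rot_pow (n : ℕ) : (Set.range Λ.rot ^ n).Finite := by
  induction n with
  | zero => simp
  | succ n ih =>
    rw [pow_succ]
    exact ih.mul (Set.finite_range _)

lemma linearParts_finite (n : ℕ) : (Λ.linearParts n).Finite :=
  ((Set.finite_range _).prod (Λ.finite_range_rot_pow n)).subset (Λ.linearParts_subset n)

lemma ncard_linearParts_le (n : ℕ) :
    (Λ.linearParts n).ncard ≤ (n + 1) ^ Λ.N * (Set.range Λ.rot ^ n).ncard := by
  refine (Set.ncard_le_ncard (Λ.linearParts_subset n)
    ((Set.finite_range _).prod (Λ.finite_range_rot_pow n))).trans ?_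
  rw [Set.ncard_prod]
  gcongr
  rw [← Set.image_univ]
  refine (Set.ncard_image_le Set.finite_univ).trans ?_
  simp [Set.ncard_univ, Nat.card_eq_fintype_card]

/-- The linear parts of the similarities of a non-expanding system at a given scale are few. -/
lemma exists_linearParts_at_scale (hΛ : NonExpanding (Set.range Λ.rot)) {c : ℝ} (hc : 0 < c)
    (hc1 : c < 1) {ε : ℝ} (hε : 0 < ε) :
    ∃ C : ℝ, 0 ≤ C ∧ ∀ r : ℝ, 0 < r → r < 1 →
      ∃ P : Finset (ℝ × (EuclideanSpace ℝ (Fin k) ≃ₗᵢ[ℝ] EuclideanSpace ℝ (Fin k))),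
        (P.card : ℝ) ≤ C * r ^ (-ε) ∧ (∀ p ∈ P, c * r < p.1 ∧ p.1 ≤ r) ∧
        ∀ w, c * r < Λ.wordRatio w → Λ.wordRatio w ≤ r → (Λ.wordRatio w, Λ.wordRot w) ∈ P := by
  classical
  obtain ⟨_, d, -, -, hd0, hd1, hd⟩ := Λ.exists_ratio_bounds
  have hlog : Real.log d < 0 := Real.log_neg hd0 hd1
  -- Two factors `exp (δ n)` will occur, one for the rotations and one absorbing polynomial factors;
  -- at `n = L` together they equal `(c * r) ^ (-ε)`.
  set δ : ℝ := ε * (-Real.log d) / 2 with hδ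
  have hδ0 : 0 < δ := by
    have : 0 < ε * (-Real.log d) := mul_pos hε (by linarith)
    positivity
  obtain ⟨C₁, hC₁⟩ := hΛ.2 δ hδ0
  have hC₁0 : 0 ≤ C₁ := by
    have := (Nat.cast_nonneg _).trans (hC₁ 0)
    simpa using this
  -- The power `Λ.N` counts ratios; the additional one comes from summing over word lengths.
  obtain ⟨C₂, hC₂0, hC₂⟩ : ∃ C : ℝ, 0 ≤ C ∧ ∀ n : ℕ,
      ((n : ℝ) + 1) ^ (Λ.N + 1) ≤ C * Real.exp (δ * n) := by
    refine ⟨(Λ.N + 1).factorial / δ ^ (Λ.N + 1) * Real.exp δ, by positivity, fun n => ?_⟩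
    have h := Real.pow_div_factorial_le_exp (δ * ((n : ℝ) + 1)) (by positivity) (Λ.N + 1)
    rw [mul_pow, mul_add, mul_one, Real.exp_add, div_le_iff₀ (by positivity)] at h
    rw [div_mul_eq_mul_div, div_mul_eq_mul_div, le_div_iff₀ (by positivity)]
    linarith
  refine ⟨C₂ * C₁ * c ^ (-ε), by positivity, fun r hr hr1 => ?_⟩
  -- Since a word of length `n` has ratio at most `d ^ n`, ratio above `c * r` forces `n ≤ L`.
  set L : ℝ := Real.log (c * r) / Real.log d with hL
  have hcr : c * r < 1 := by nlinarith
  have hL0 : 0 ≤ L := div_nonneg_of_nonpos (Real.log_nonpos (by positivity) hcr.le) hlog.le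
  have hfin : (⋃ n ∈ Finset.range (⌊L⌋₊ + 1), Λ.linearParts n).Finite :=
    Set.Finite.biUnion (Finset.finite_toSet _) fun n _ => Λ.linearParts_finite n
  refine ⟨hfin.toFinset.filter fun p => c * r < p.1 ∧ p.1 ≤ r, ?_, ?_, ?_⟩
  · have h1 : (hfin.toFinset.card : ℝ) ≤
        ∑ n ∈ Finset.range (⌊L⌋₊ + 1), ((Λ.linearParts n).ncard : ℝ) := by
      rw [← Set.ncard_eq_toFinset_card _ hfin]
      exact_mod_cast Finset.set_ncard_biUnion_le _ _
    have h2 : ∀ n ∈ Finset.range (⌊L⌋₊ + 1), ((Λ.linearParts n).ncard : ℝ) ≤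
        ((⌊L⌋₊ : ℝ) + 1) ^ Λ.N * (C₁ * Real.exp (δ * ⌊L⌋₊)) := by
      intro n hn
      have hn' : (n : ℝ) ≤ ⌊L⌋₊ := by
        exact_mod_cast Nat.lt_succ_iff.1 (Finset.mem_range.1 hn)
      calc ((Λ.linearParts n).ncard : ℝ)
          ≤ ((n : ℝ) + 1) ^ Λ.N * ((Set.range Λ.rot ^ n).ncard : ℝ) := by
            exact_mod_cast Λ.ncard_linearParts_le n
        _ ≤ ((n : ℝ) + 1) ^ Λ.N * (C₁ * Real.exp (δ * n)) := by
            gcongr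
            exact hC₁ n
        _ ≤ _ := by gcongr
    calc ((hfin.toFinset.filter fun p => c * r < p.1 ∧ p.1 ≤ r).card : ℝ)
        ≤ hfin.toFinset.card := by exact_mod_cast Finset.card_filter_le _ _
      _ ≤ ((⌊L⌋₊ : ℝ) + 1) * (((⌊L⌋₊ : ℝ) + 1) ^ Λ.N * (C₁ * Real.exp (δ * ⌊L⌋₊))) := by
          refine h1.trans ((Finset.sum_le_sum h2).trans (le_of_eq ?_))
          simp
      _ = ((⌊L⌋₊ : ℝ) + 1) ^ (Λ.N + 1) * (C₁ * Real.exp (δ * ⌊L⌋₊)) := by ring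
      _ ≤ C₂ * Real.exp (δ * ⌊L⌋₊) * (C₁ * Real.exp (δ * ⌊L⌋₊)) := by
          gcongr
          exact hC₂ _
      _ = C₂ * C₁ * Real.exp (2 * δ * ⌊L⌋₊) := by
          rw [two_mul, add_mul, Real.exp_add]
          ring
      _ ≤ C₂ * C₁ * Real.exp (2 * δ * L) := by
          gcongr
          exact Nat.floor_le hL0
      _ = C₂ * C₁ * c ^ (-ε) * r ^ (-ε) := by
          rw [mul_assoc (C₂ * C₁), ← Real.mul_rpow hc.le hr.le,
            Real.rpow_def_of_pos (by positivity)]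
          congr 2
          rw [hδ, hL]
          have := hlog.ne
          field_simp
  · intro p hp
    exact (Finset.mem_filter.1 hp).2
  · intro w hw hw'
    refine Finset.mem_filter.2 ⟨?_, hw, hw'⟩
    rw [Set.Finite.mem_toFinset]
    refine Set.mem_iUnion₂.2 ⟨w.length, ?_, w, rfl, rfl⟩
    rw [Finset.mem_range, Nat.lt_succ_iff]
    refine Nat.le_floor ?_
    rw [hL, le_div_iff_of_neg hlog, ← Real.log_pow]
    exact Real.log_le_log (by positivity)
      (hw.le.trans (Λ.wordRatio_le_pow (fun i => (hd i).2) w))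

variable {Λ}

lemma integral_eq_sum {G : Type*} [NormedAddCommGroup G] [NormedSpace ℝ G]
    {μ : Measure (EuclideanSpace ℝ (Fin k))} [IsProbabilityMeasure μ] {p : Fin Λ.N → ℝ}
    (hp : ∀ i, 0 < p i) (hμ : μ = ∑ i, ENNReal.ofReal (p i) • μ.map (Λ.map i))
    {F : EuclideanSpace ℝ (Fin k) → G} (hF : ∀ i, Integrable (fun x => F (Λ.map i x)) μ)
    (hFm : StronglyMeasurable F) :
    ∫ x, F x ∂μ = ∑ i, p i • ∫ x, F (Λ.map i x) ∂μ := by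
  have h0 : ∀ i, AEMeasurable (Λ.map i) μ := fun i => (Λ.continuous_map i).measurable.aemeasurable
  calc ∫ x, F x ∂μ = ∫ x, F x ∂(∑ i, ENNReal.ofReal (p i) • μ.map (Λ.map i)) := by rw [← hμ]
    _ = ∑ i, ∫ x, F x ∂(ENNReal.ofReal (p i) • μ.map (Λ.map i)) := by
        refine integral_finsetSum_measure fun i _ => ?_
        refine Integrable.smul_measure ?_ ENNReal.ofReal_ne_top
        exact (integrable_map_measure hFm.aestronglyMeasurable (h0 i)).2 (hF i)
    _ = _ := by
        refine Finset.sum_congr rfl fun i _ => ?_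
        rw [integral_smul_measure, integral_map (h0 i) hFm.aestronglyMeasurable,
          ENNReal.toReal_ofReal (hp i).le]

/-- A bound for the words stopped at scale `r` passes to the full measure. -/
lemma norm_integral_le_of_stopped {μ : Measure (EuclideanSpace ℝ (Fin k))} [IsProbabilityMeasure μ]
    {p : Fin Λ.N → ℝ} (hp : ∀ i, 0 < p i) (hp1 : ∑ i, p i = 1)
    (hμ : μ = ∑ i, ENNReal.ofReal (p i) • μ.map (Λ.map i))
    {F : EuclideanSpace ℝ (Fin k) → ℂ} (hF : Continuous F) {M : ℝ} (hFM : ∀ x, ‖F x‖ ≤ M)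
    {H : EuclideanSpace ℝ (Fin k) → ℝ} (hH : Continuous H) {M' : ℝ} (hHM : ∀ x, ‖H x‖ ≤ M')
    {c r ε : ℝ} (hc : ∀ i, c ≤ Λ.ratio i) (hr0 : 0 < r) (hr1 : r < 1)
    (hcyl : ∀ w, c * r < Λ.wordRatio w → Λ.wordRatio w ≤ r →
      ‖∫ x, F (Λ.wordMap w x) ∂μ‖ ≤ ∫ x, H (Λ.wordMap w x) ∂μ + ε) :
    ‖∫ x, F x ∂μ‖ ≤ ∫ x, H x ∂μ + ε := by
  obtain ⟨_, d, -, -, hd0, hd1, hd⟩ := Λ.exists_ratio_bounds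
  -- Words are extended on the right while their ratio exceeds `r`; `n` bounds the remaining
  -- extensions. The last letter shrinks the ratio by at least `c`, so a stopped word stays above `c
  -- * r`.
  have key : ∀ (n : ℕ) (w : List (Fin Λ.N)), r < Λ.wordRatio w → Λ.wordRatio w * d ^ n ≤ r →
      ‖∫ x, F (Λ.wordMap w x) ∂μ‖ ≤ ∫ x, H (Λ.wordMap w x) ∂μ + ε := by
    intro n
    induction n with
    | zero => intro w h1 h2; simp at h2; linarith
    | succ n ih =>
      intro w h1 h2
      have hi : ∀ i, ‖∫ x, F (Λ.wordMap (w ++ [i]) x) ∂μ‖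
          ≤ ∫ x, H (Λ.wordMap (w ++ [i]) x) ∂μ + ε := by
        intro i
        by_cases h : Λ.wordRatio (w ++ [i]) ≤ r
        · refine hcyl _ ?_ h
          rw [wordRatio_append]
          nlinarith [hc i, Λ.ratio_pos i]
        · refine ih _ (not_le.1 h) ?_
          rw [wordRatio_append]
          refine le_trans ?_ h2
          rw [pow_succ', mul_assoc]
          have := Λ.wordRatio_pos w
          gcongr
          exact (hd i).2
      have hFi := integral_eq_sum hp hμ (F := fun x => F (Λ.wordMap w x)) (fun i =>
        Integrable.of_bound (C := M) ((hF.comp (Λ.continuous_wordMap w)).comp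
          (Λ.continuous_map i)).aestronglyMeasurable (.of_forall fun x => hFM _))
          (hF.comp (Λ.continuous_wordMap w)).stronglyMeasurable
      have hHi := integral_eq_sum hp hμ (F := fun x => H (Λ.wordMap w x)) (fun i =>
        Integrable.of_bound (C := M') ((hH.comp (Λ.continuous_wordMap w)).comp
          (Λ.continuous_map i)).aestronglyMeasurable (.of_forall fun x => hHM _))
          (hH.comp (Λ.continuous_wordMap w)).stronglyMeasurable
      simp only [wordMap_append] at hi
      rw [hFi, hHi]
      calc ‖∑ i, p i • ∫ x, F (Λ.wordMap w (Λ.map i x)) ∂μ‖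
          ≤ ∑ i, ‖p i • ∫ x, F (Λ.wordMap w (Λ.map i x)) ∂μ‖ := norm_sum_le _ _
        _ ≤ ∑ i, p i * (∫ x, H (Λ.wordMap w (Λ.map i x)) ∂μ + ε) := by
            refine Finset.sum_le_sum fun i _ => ?_
            rw [norm_smul, Real.norm_of_nonneg (hp i).le]
            exact mul_le_mul_of_nonneg_left (hi i) (hp i).le
        _ = _ := by
            simp only [mul_add, Finset.sum_add_distrib, ← Finset.sum_mul, hp1, one_mul, smul_eq_mul]
  obtain ⟨n, hn⟩ := exists_pow_lt_of_lt_one hr0 hd1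
  exact key n [] (by simpa [wordRatio] using hr1) (by simpa [wordRatio] using hn.le)

/-- Linearization of the phase on a cylinder. -/
lemma norm_integral_cylinder_le {μ : Measure (EuclideanSpace ℝ (Fin k))} [IsProbabilityMeasure μ]
    {K : Set (EuclideanSpace ℝ (Fin k))} (hK : ∀ i, ∀ x ∈ K, Λ.map i x ∈ K)
    (hμK : ∀ᵐ x ∂μ, x ∈ K) {D : ℝ} (hD : ∀ x ∈ K, ∀ y ∈ K, ‖y - x‖ ≤ D)
    {f : EuclideanSpace ℝ (Fin k) → ℝ} (hf : ContDiff ℝ 2 f) {C : ℝ} (hC : 0 ≤ C)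
    (hT : ∀ x ∈ K, ∀ y ∈ K, |f y - f x - inner ℝ (gradient f x) (y - x)| ≤ C * ‖y - x‖ ^ 2)
    (ξ : ℝ) (w : List (Fin Λ.N)) :
    ‖∫ y, ((Real.fourierChar (-(f (Λ.wordMap w y) * ξ)) : Circle) : ℂ) ∂μ‖ ≤
      ∫ x, ‖fourierTransform μ
        ((Λ.wordRatio w * ξ) • (Λ.wordRot w).symm (gradient f (Λ.wordMap w x)))‖ ∂μ
        + 2 * Real.pi * C * D ^ 2 * |ξ| * Λ.wordRatio w ^ 2 := by
  set ρ := Λ.wordRatio w with hρ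
  have hρ0 : 0 < ρ := Λ.wordRatio_pos w
  have hgc : Continuous (gradient f) := (contDiff_gradient hf).continuous
  have hwc := Λ.continuous_wordMap w
  have hfc := hf.continuous
  have hfw : Continuous fun y => f (Λ.wordMap w y) := hfc.comp hwc
  have hint : Integrable (fun y =>
      ((Real.fourierChar (-(f (Λ.wordMap w y) * ξ)) : Circle) : ℂ)) μ := by
    refine Integrable.of_bound (C := 1) ?_ (.of_forall fun y => (Circle.norm_coe _).le)
    exact (by fun_prop : Continuous fun y =>
      ((Real.fourierChar (-(f (Λ.wordMap w y) * ξ)) : Circle) : ℂ)).aestronglyMeasurable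
  have hpt : ∀ x ∈ K, ‖∫ y, ((Real.fourierChar (-(f (Λ.wordMap w y) * ξ)) : Circle) : ℂ) ∂μ‖ ≤
      ‖fourierTransform μ ((ρ * ξ) • (Λ.wordRot w).symm (gradient f (Λ.wordMap w x)))‖
        + 2 * Real.pi * C * D ^ 2 * |ξ| * ρ ^ 2 := by
    intro x hx
    set z := Λ.wordMap w x with hz
    set θ := (ρ * ξ) • (Λ.wordRot w).symm (gradient f z) with hθ
    -- The constant part of the linearized phase only contributes a factor of modulus one.
    set a : ℝ := -(f z * ξ) + inner ℝ θ x with ha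
    have h1 : ‖fourierTransform μ θ‖ =
        ‖∫ y, ((Real.fourierChar (a - inner ℝ θ y) : Circle) : ℂ) ∂μ‖ := by
      have : ∀ y, ((Real.fourierChar (a - inner ℝ θ y) : Circle) : ℂ)
          = ((Real.fourierChar a : Circle) : ℂ) *
            ((Real.fourierChar (-(inner ℝ θ y)) : Circle) : ℂ) := by
        intro y
        rw [← Circle.coe_mul, ← AddChar.map_add_eq_mul, sub_eq_add_neg]
      simp_rw [this]
      rw [integral_const_mul, norm_mul, Circle.norm_coe, one_mul, fourierTransform_eq]
    have hint2 : Integrable (fun y => ((Real.fourierChar (a - inner ℝ θ y) : Circle) : ℂ)) μ := by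
      refine Integrable.of_bound (C := 1) ?_ (.of_forall fun y => (Circle.norm_coe _).le)
      exact (by fun_prop : Continuous fun y =>
        ((Real.fourierChar (a - inner ℝ θ y) : Circle) : ℂ)).aestronglyMeasurable
    rw [h1]
    refine (norm_le_norm_add_norm_sub' _ _).trans (add_le_add_right ?_ _)
    rw [← integral_sub hint hint2]
    refine (norm_integral_le_of_norm_le_const (C := 2 * Real.pi * C * D ^ 2 * |ξ| * ρ ^ 2) ?_).trans
      (by simp)
    filter_upwards [hμK] with y hy
    refine (norm_fourierChar_sub_le _ _).trans ?_
    have h2 := hT z (Λ.wordMap_mem hK w hx) (Λ.wordMap w y) (Λ.wordMap_mem hK w hy)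
    have h3 : Λ.wordMap w y - z = ρ • Λ.wordRot w (y - x) := Λ.wordMap_sub w y x
    have h4 : inner ℝ θ (y - x) = ξ * inner ℝ (gradient f z) (Λ.wordMap w y - z) := by
      have h7 := (Λ.wordRot w).inner_map_eq_flip (y - x) (gradient f z)
      rw [real_inner_comm, real_inner_comm _ (y - x)] at h7
      rw [h3, hθ, real_inner_smul_left, real_inner_smul_right, h7]
      ring
    have h5 : -(f (Λ.wordMap w y) * ξ) - (a - inner ℝ θ y)
        = -ξ * (f (Λ.wordMap w y) - f z - inner ℝ (gradient f z) (Λ.wordMap w y - z)) := by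
      rw [inner_sub_right] at h4
      rw [ha]
      linear_combination h4
    have h6 : ‖Λ.wordMap w y - z‖ ≤ ρ * D := by
      rw [h3, norm_smul, LinearIsometryEquiv.norm_map, Real.norm_of_nonneg hρ0.le]
      gcongr
      exact hD x hx y hy
    rw [h5, abs_mul, abs_neg]
    calc 2 * Real.pi * (|ξ| * |f (Λ.wordMap w y) - f z -
            inner ℝ (gradient f z) (Λ.wordMap w y - z)|)
        ≤ 2 * Real.pi * (|ξ| * (C * (ρ * D) ^ 2)) := by
          have := Real.pi_pos
          gcongr
          exact h2.trans (by gcongr)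
      _ = _ := by ring
  have hcont : Continuous fun x => ‖fourierTransform μ
      ((ρ * ξ) • (Λ.wordRot w).symm (gradient f (Λ.wordMap w x)))‖ := by
    have h1 := continuous_fourierTransform μ
    have h2 := (Λ.wordRot w).symm.continuous
    fun_prop
  have hint3 : Integrable (fun x => ‖fourierTransform μ
      ((ρ * ξ) • (Λ.wordRot w).symm (gradient f (Λ.wordMap w x)))‖) μ := by
    refine Integrable.of_bound (C := 1) hcont.aestronglyMeasurable (.of_forall fun x => ?_)
    rw [norm_norm]
    exact norm_fourierTransform_le_one μ _
  -- The left side does not depend on the base point `x`, so the pointwise bound may be averaged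
  -- over `x`; this creates the integral over gradients.
  have hfinal := integral_mono_ae (integrable_const
    ‖∫ y, ((Real.fourierChar (-(f (Λ.wordMap w y) * ξ)) : Circle) : ℂ) ∂μ‖)
    (hint3.add (integrable_const (2 * Real.pi * C * D ^ 2 * |ξ| * ρ ^ 2)))
    (by filter_upwards [hμK] with x hx using hpt x hx)
  rw [integral_add' hint3 (integrable_const _)] at hfinal
  simpa using hfinal

end SelfSimilarIFS

/-! ### Reduction to averages along the gradient. -/

lemma IsNonExpandingSelfSimilar.isProbabilityMeasure {k : ℕ}
    {μ : Measure (EuclideanSpace ℝ (Fin k))} (hμ : IsNonExpandingSelfSimilar μ) :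
    IsProbabilityMeasure μ := by
  obtain ⟨Λ, -, h, -⟩ := hμ
  exact h

lemma IsNonExpandingSelfSimilar.isCompact_support {k : ℕ}
    {μ : Measure (EuclideanSpace ℝ (Fin k))} (hμ : IsNonExpandingSelfSimilar μ) :
    IsCompact μ.support := by
  obtain ⟨Λ, -, -, ⟨K, hK, -, hK0⟩, -⟩ := hμ
  exact hK.of_isClosed_subset Measure.isClosed_support
    (Measure.support_subset_of_isClosed hK.isClosed hK0)

/-- Reduction of the decay of a nonlinear image of a non-expanding self-similar measure to averages
of its Fourier transform over dilated rotated gradient images. -/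
lemma IsNonExpandingSelfSimilar.exists_norm_fourierTransform_map_le {k : ℕ}
    {μ : Measure (EuclideanSpace ℝ (Fin k))} (hμ : IsNonExpandingSelfSimilar μ)
    {f : EuclideanSpace ℝ (Fin k) → ℝ} (hf : ContDiff ℝ 2 f) :
    ∃ c C : ℝ, 0 < c ∧ 0 ≤ C ∧ ∀ ε : ℝ, 0 < ε → ∃ C' : ℝ, 0 ≤ C' ∧ ∀ ξ r B : ℝ, 0 < r → r < 1 →
      (∀ (ρ : ℝ) (O : EuclideanSpace ℝ (Fin k) ≃ₗᵢ[ℝ] EuclideanSpace ℝ (Fin k)),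
        c * r < ρ → ρ ≤ r →
        ∫ x, ‖fourierTransform μ ((ρ * ξ) • O (gradient f x))‖ ∂μ ≤ B) →
      ‖fourierTransform (μ.map f) ξ‖ ≤ C' * r ^ (-ε) * B + C * |ξ| * r ^ 2 := by
  have := hμ.isProbabilityMeasure
  obtain ⟨Λ, hΛ, -, ⟨K, hK, hKΛ, hK0⟩, p, hp, hp1, hμp⟩ := hμ
  obtain ⟨c, d, hc, hc1, -, -, hcd⟩ := Λ.exists_ratio_bounds
  obtain ⟨C, hC, hT⟩ := exists_taylor_bound hf hK
  obtain ⟨D, hD⟩ := hK.isBounded.exists_norm_le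
  have hD0 : ∀ x ∈ K, ∀ y ∈ K, ‖y - x‖ ≤ 2 * D := fun x hx y hy => by
    linarith [norm_sub_le y x, hD x hx, hD y hy]
  have hKmap : ∀ i, ∀ x ∈ K, Λ.map i x ∈ K := fun i x hx => by
    rw [hKΛ]
    exact Set.mem_iUnion.2 ⟨i, x, hx, rfl⟩
  have hμK : ∀ᵐ x ∂μ, x ∈ K := hK0
  have hπ := Real.pi_pos
  refine ⟨c, 2 * Real.pi * C * (2 * D) ^ 2, hc, by positivity, fun ε hε => ?_⟩
  obtain ⟨C', hC', hP⟩ := Λ.exists_linearParts_at_scale hΛ hc hc1 hε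
  refine ⟨C', hC', fun ξ r B hr0 hr1 hB => ?_⟩
  obtain ⟨P, hPcard, hPr, hPmem⟩ := hP r hr0 hr1
  have hgc : Continuous (gradient f) := (contDiff_gradient hf).continuous
  have hfc := hf.continuous
  have hterm : ∀ q : ℝ × (EuclideanSpace ℝ (Fin k) ≃ₗᵢ[ℝ] EuclideanSpace ℝ (Fin k)),
      Continuous fun x => ‖fourierTransform μ ((q.1 * ξ) • q.2.symm (gradient f x))‖ := by
    intro q
    have h1 := continuous_fourierTransform μ
    have h2 := q.2.symm.continuous
    fun_prop
  have hterm1 : ∀ (q : ℝ × (EuclideanSpace ℝ (Fin k) ≃ₗᵢ[ℝ] EuclideanSpace ℝ (Fin k))) x,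
      ‖fourierTransform μ ((q.1 * ξ) • q.2.symm (gradient f x))‖ ≤ 1 :=
    fun q x => norm_fourierTransform_le_one μ _
  have hterm2 : ∀ q : ℝ × (EuclideanSpace ℝ (Fin k) ≃ₗᵢ[ℝ] EuclideanSpace ℝ (Fin k)),
      Integrable (fun x => ‖fourierTransform μ ((q.1 * ξ) • q.2.symm (gradient f x))‖) μ :=
    fun q => Integrable.of_bound (C := 1) (hterm q).aestronglyMeasurable
      (.of_forall fun x => by rw [norm_norm]; exact hterm1 q x)
  -- Summing over all linear parts gives one majorant valid for every stopped word, so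
  -- self-similarity recombines the cylinder bounds into `∫ H ∂μ`.
  set H : EuclideanSpace ℝ (Fin k) → ℝ := fun x =>
    ∑ q ∈ P, ‖fourierTransform μ ((q.1 * ξ) • q.2.symm (gradient f x))‖ with hH
  have hHc : Continuous H := continuous_finsetSum _ fun q _ => hterm q
  have hHb : ∀ x, ‖H x‖ ≤ P.card := by
    intro x
    rw [Real.norm_of_nonneg (Finset.sum_nonneg fun q _ => norm_nonneg _)]
    exact (Finset.sum_le_card_nsmul _ _ 1 fun q _ => hterm1 q x).trans (by simp)
  have hle : ∀ q ∈ P, ∀ x,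
      ‖fourierTransform μ ((q.1 * ξ) • q.2.symm (gradient f x))‖ ≤ H x := by
    intro q hq x
    have h0 : ∀ q' ∈ P,
        0 ≤ ‖fourierTransform μ ((q'.1 * ξ) • q'.2.symm (gradient f x))‖ :=
      fun q' _ => norm_nonneg _
    exact Finset.single_le_sum h0 hq
  have hmain := SelfSimilarIFS.norm_integral_le_of_stopped (Λ := Λ) (μ := μ)
    (fun i => (hp i).1) hp1 hμp
    (F := fun y => ((Real.fourierChar (-(f y * ξ)) : Circle) : ℂ)) (by fun_prop) (M := 1)
    (fun x => (Circle.norm_coe _).le) hHc hHb (c := c) (r := r)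
    (ε := 2 * Real.pi * C * (2 * D) ^ 2 * |ξ| * r ^ 2) (fun i => (hcd i).1) hr0 hr1 (by
      intro w hw hw'
      refine (SelfSimilarIFS.norm_integral_cylinder_le hKmap hμK hD0 hf hC hT ξ w).trans ?_
      have hwm := Λ.continuous_wordMap w
      refine add_le_add ?_ ?_
      · refine integral_mono ?_ ?_ ?_
        · refine Integrable.of_bound (C := 1)
            ((hterm (Λ.wordRatio w, Λ.wordRot w)).comp hwm).aestronglyMeasurable
            (.of_forall fun x => ?_)
          rw [norm_norm]
          exact norm_fourierTransform_le_one μ _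
        · exact Integrable.of_bound (C := P.card) (hHc.comp hwm).aestronglyMeasurable (.of_forall fun x => hHb _)
        · intro x
          exact hle _ (hPmem w hw hw') _
      · have := Λ.wordRatio_pos w
        gcongr)
  have h1 : fourierTransform (μ.map f) ξ
      = ∫ y, ((Real.fourierChar (-(f y * ξ)) : Circle) : ℂ) ∂μ := by
    rw [fourierTransform_eq, integral_map hfc.aemeasurable
      (by fun_prop : Continuous fun x : ℝ =>
        ((Real.fourierChar (-(inner ℝ ξ x)) : Circle) : ℂ)).aestronglyMeasurable]
    simp only [RCLike.inner_apply, conj_trivial]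
  have h2 : ∫ x, H x ∂μ ≤ P.card * B := by
    rw [hH, integral_finsetSum _ fun q _ => hterm2 q]
    refine (Finset.sum_le_card_nsmul _ _ B fun q hq => ?_).trans (by simp)
    exact hB q.1 q.2.symm (hPr q hq).1 (hPr q hq).2
  have hB1 : 0 ≤ B := by
    refine le_trans (integral_nonneg fun x => norm_nonneg _)
      (hB r (LinearIsometryEquiv.refl ℝ _) (by nlinarith) le_rfl)
  rw [h1]
  refine hmain.trans (add_le_add_left (h2.trans ?_) _)
  gcongr

/-! ### The ball-counting measure and sampling along maps with small fibres. -/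

section Energy

/-- The measure `μ` renormalized by the mass of balls of radius `r`, so that its mass counts
`r`-balls. -/
noncomputable def ballCountingMeasure {X : Type*} [PseudoMetricSpace X] [MeasurableSpace X]
    (μ : Measure X) (r : ℝ) : Measure X :=
  μ.withDensity fun x => (μ (Metric.ball x r))⁻¹

section General

variable {X : Type*} [PseudoMetricSpace X] [MeasurableSpace X] [BorelSpace X]
  [SecondCountableTopology X] {μ : Measure X} [IsFiniteMeasure μ]

omit [SecondCountableTopology X] in
lemma ballCountingMeasure_le {r : ℝ} {A : Set X} (hAm : MeasurableSet A) {t : Finset X}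
    {Y : Set X} (hY : ∀ᵐ x ∂μ, x ∈ Y) (hA : A ∩ Y ⊆ ⋃ y ∈ t, Metric.ball y (r / 2)) :
    ballCountingMeasure μ r A ≤ t.card := by
  rw [ballCountingMeasure, withDensity_apply _ hAm]
  refine le_trans (le_of_eq ?_) (setLIntegral_inv_measure_ball_le μ hA)
  refine (setLIntegral_congr ?_).symm
  filter_upwards [hY] with x hx
  exact propext ⟨fun h => h.1, fun h => ⟨h, hx⟩⟩

lemma lintegral_ballCountingMeasure (r : ℝ) {u : X → ℝ≥0∞} (hu : Measurable u) :
    ∫⁻ x, u x ∂(ballCountingMeasure μ r) = ∫⁻ x, (μ (Metric.ball x r))⁻¹ * u x ∂μ :=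
  lintegral_withDensity_eq_lintegral_mul μ (measurable_measure_ball μ r).inv hu

omit [BorelSpace X] [IsFiniteMeasure μ] in
lemma ae_measure_ball_ne_zero {r : ℝ} (hr : 0 < r) : ∀ᵐ x ∂μ, μ (Metric.ball x r) ≠ 0 := by
  filter_upwards [Measure.support_mem_ae (μ := μ)] with x hx
  exact ((Measure.mem_support_iff_forall x).1 hx _ (Metric.ball_mem_nhds x hr)).ne'

lemma lintegral_le_mul_lintegral_ballCountingMeasure {r : ℝ} (hr : 0 < r) {W : ℝ≥0∞}
    (hW : ∀ x, μ (Metric.ball x r) ≤ W) {u : X → ℝ≥0∞} (hu : Measurable u) :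
    ∫⁻ x, u x ∂μ ≤ W * ∫⁻ x, u x ∂(ballCountingMeasure μ r) := by
  rw [lintegral_ballCountingMeasure r hu, ← lintegral_const_mul _
    (f := fun x => (μ (Metric.ball x r))⁻¹ * u x) ((measurable_measure_ball μ r).inv.mul hu)]
  refine lintegral_mono_ae ?_
  filter_upwards [ae_measure_ball_ne_zero (μ := μ) hr] with x hx
  calc u x = μ (Metric.ball x r) * ((μ (Metric.ball x r))⁻¹ * u x) := by
        rw [← mul_assoc, ENNReal.mul_inv_cancel hx (measure_ne_top _ _), one_mul]
    _ ≤ _ := by gcongr; exact hW x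

/-- Pointwise `u ≤ t w + u² / (t w)` with `w = μ (ball x r)`. This is Cauchy–Schwarz with the
balancing parameter `t` left free, which avoids square roots. -/
lemma lintegral_le_add_lintegral_ballCountingMeasure {r : ℝ} (hr : 0 < r) {t : ℝ} (ht : 0 < t)
    {u : X → ℝ} (hu : Measurable u) (hu0 : ∀ x, 0 ≤ u x) :
    ∫⁻ x, ENNReal.ofReal (u x) ∂μ ≤ ENNReal.ofReal t * ∫⁻ x, μ (Metric.ball x r) ∂μ +
      ENNReal.ofReal t⁻¹ * ∫⁻ x, ENNReal.ofReal (u x ^ 2) ∂(ballCountingMeasure μ r) := by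
  have hu2 : Measurable fun x => ENNReal.ofReal (u x ^ 2) := (hu.pow_const 2).ennreal_ofReal
  rw [lintegral_ballCountingMeasure r hu2, ← lintegral_const_mul _ (measurable_measure_ball μ r),
    ← lintegral_const_mul _ (f := fun x => (μ (Metric.ball x r))⁻¹ * ENNReal.ofReal (u x ^ 2))
      ((measurable_measure_ball μ r).inv.mul hu2),
    ← lintegral_add_left ((measurable_measure_ball μ r).const_mul _)]
  refine lintegral_mono_ae ?_
  filter_upwards [ae_measure_ball_ne_zero (μ := μ) hr] with x hx
  have hw : 0 < μ.real (Metric.ball x r) := ENNReal.toReal_pos hx (measure_ne_top _ _)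
  rw [← ofReal_measureReal (μ := μ) (s := Metric.ball x r), ← ENNReal.ofReal_inv_of_pos hw,
    ← ENNReal.ofReal_mul ht.le, ← ENNReal.ofReal_mul (by positivity),
    ← ENNReal.ofReal_mul (by positivity), ← ENNReal.ofReal_add (by positivity) (by positivity)]
  refine ENNReal.ofReal_le_ofReal ?_
  set w := μ.real (Metric.ball x r)
  have h1 : t⁻¹ * (w⁻¹ * u x ^ 2) = u x ^ 2 / (t * w) := by
    field_simp
  have h2 : 0 < t * w := by positivity
  rw [h1, ← sub_nonneg]
  have h3 : t * w + u x ^ 2 / (t * w) - u x = ((t * w - u x) ^ 2 + t * w * u x) / (t * w) := by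
    field_simp
    ring
  rw [h3]
  have := hu0 x
  positivity

end General

section Cover

variable {F : Type*} [NormedAddCommGroup F]

/-- The covering property at exponent `α` with constant `C`. -/
def HasCoverExponent (A : Set F) (α C : ℝ) : Prop :=
  ∀ r R : ℝ, 0 < r → r < R → ∀ x ∈ A, ∃ t : Finset F, (t.card : ℝ) ≤ C * (R / r) ^ α ∧
    Metric.ball x R ∩ A ⊆ ⋃ y ∈ t, Metric.ball y (r / 2)

/-- Two points of one piece whose images lie in a common `T`-ball are less than `2T / c` apart, so
each piece of the fibre sits in a single ball centred in `A`. -/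
lemma exists_cover_preimage_ball {A : Set F} {α C : ℝ} (hC : 0 ≤ C) (hA : HasCoverExponent A α C)
    {𝒮 : Finset (Set F)} (h𝒮 : A ⊆ ⋃ S ∈ 𝒮, S) {ψ : F → F} {c : ℝ} (hc : 0 < c)
    (hψ : ∀ S ∈ 𝒮, LowerLipschitzOn c ψ S) {r T : ℝ} (hr : 0 < r) (hrT : r < 2 * T / c) (ζ : F) :
    ∃ t : Finset F, (t.card : ℝ) ≤ 𝒮.card * C * (2 * T / (c * r)) ^ α ∧
      (ψ ⁻¹' Metric.ball ζ T) ∩ A ⊆ ⋃ y ∈ t, Metric.ball y (r / 2) := by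
  classical
  have hT : 0 ≤ 2 * T / (c * r) := by
    rw [← div_div]
    exact div_nonneg (hr.le.trans hrT.le) hr.le
  have h1 : ∀ S ∈ 𝒮, ∃ t : Finset F, (t.card : ℝ) ≤ C * (2 * T / (c * r)) ^ α ∧
      (ψ ⁻¹' Metric.ball ζ T) ∩ A ∩ S ⊆ ⋃ y ∈ t, Metric.ball y (r / 2) := by
    intro S hS
    rcases ((ψ ⁻¹' Metric.ball ζ T) ∩ A ∩ S).eq_empty_or_nonempty with h | ⟨x, ⟨hx, hxA⟩, hxS⟩
    · exact ⟨∅, by simp only [Finset.card_empty, Nat.cast_zero]; positivity, by simp [h]⟩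
    · obtain ⟨t, ht, htc⟩ := hA r (2 * T / c) hr hrT x hxA
      refine ⟨t, by rwa [← div_div], fun y hy => htc ⟨?_, hy.1.2⟩⟩
      have h2 := hψ S hS y hy.2 x hxS
      have h3 : ‖ψ y - ψ x‖ < 2 * T := by
        rw [← dist_eq_norm]
        have h4 := dist_triangle_right (ψ y) (ψ x) ζ
        have h5 := Metric.mem_ball.1 hx
        have h6 := Metric.mem_ball.1 hy.1.1
        linarith
      rw [Metric.mem_ball, dist_eq_norm, lt_div_iff₀ hc]
      linarith
  choose! t ht htc using h1
  refine ⟨𝒮.biUnion t, ?_, ?_⟩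
  · calc ((𝒮.biUnion t).card : ℝ) ≤ ∑ S ∈ 𝒮, ((t S).card : ℝ) := by
          exact_mod_cast Finset.card_biUnion_le
      _ ≤ ∑ S ∈ 𝒮, C * (2 * T / (c * r)) ^ α := Finset.sum_le_sum ht
      _ = _ := by simp [mul_assoc]
  · intro x hx
    obtain ⟨S, hS, hxS⟩ := Set.mem_iUnion₂.1 (h𝒮 hx.2)
    obtain ⟨y, hy, hxy⟩ := Set.mem_iUnion₂.1 (htc S hS ⟨hx, hxS⟩)
    exact Set.mem_iUnion₂.2 ⟨y, Finset.mem_biUnion.2 ⟨S, hS, hy⟩, hxy⟩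

end Cover

section Sampling

variable {E : Type*} [NormedAddCommGroup E] [InnerProductSpace ℝ E] [FiniteDimensional ℝ E]
  [MeasurableSpace E] [BorelSpace E]

/-- Sampling a function dominated by its local averages along a map whose fibres have small mass. -/
lemma lintegral_comp_le_of_local_average (m : Measure E) [SFinite m] {g : E → ℝ}
    (hg : Continuous g) (hg0 : ∀ x, 0 ≤ g x) {C T δ : ℝ} (hC : 0 ≤ C) (hδ : 0 ≤ δ)
    (hloc : ∀ η, g η ≤ C * (∫ ζ in Metric.ball η T, g ζ) + δ)
    {ψ : E → E} (hψ : Continuous ψ) {L : ℝ} (hL : ∀ᵐ x ∂m, ‖ψ x‖ ≤ L) {M M₀ : ℝ≥0∞}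
    (hM : ∀ ζ, m (ψ ⁻¹' Metric.ball ζ T) ≤ M) (hM₀ : m Set.univ ≤ M₀) :
    ∫⁻ x, ENNReal.ofReal (g (ψ x)) ∂m ≤
      ENNReal.ofReal (C * ∫ ζ in Metric.ball 0 (L + T), g ζ) * M + ENNReal.ofReal δ * M₀ := by
  have hint : ∀ η R, IntegrableOn g (Metric.ball η R) := fun η R =>
    (hg.continuousOn.integrableOn_compact (isCompact_closedBall η R)).mono_set
      Metric.ball_subset_closedBall
  have hofReal : ∀ η R, ENNReal.ofReal (∫ ζ in Metric.ball η R, g ζ)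
      = ∫⁻ ζ in Metric.ball η R, ENNReal.ofReal (g ζ) := fun η R =>
    ofReal_integral_eq_lintegral_ofReal (hint η R) (.of_forall hg0)
  have hgm : Measurable fun ζ => ENNReal.ofReal (g ζ) := hg.measurable.ennreal_ofReal
  have hmeas : MeasurableSet {p : E × E | p.2 ∈ Metric.ball (ψ p.1) T} :=
    (isOpen_lt (by fun_prop) continuous_const : IsOpen {p : E × E | dist p.2 (ψ p.1) < T}).measurableSet
  have hker : Measurable (Function.uncurry fun x ζ =>
      (Metric.ball (ψ x) T).indicator (fun ζ => ENNReal.ofReal (g ζ)) ζ) := by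
    have : (Function.uncurry fun x ζ =>
        (Metric.ball (ψ x) T).indicator (fun ζ => ENNReal.ofReal (g ζ)) ζ)
        = {p : E × E | p.2 ∈ Metric.ball (ψ p.1) T}.indicator
          (fun p => ENNReal.ofReal (g p.2)) := by
      ext ⟨x, ζ⟩
      simp [Set.indicator, Function.uncurry]
    rw [this]
    exact (hgm.comp measurable_snd).indicator hmeas
  -- Tonelli reverses roles: `ζ` is near `ψ x` exactly when `x` is in the fibre over `ball ζ T`. No
  -- `ζ` outside `ball 0 (L + T)` is near the range.
  have hinner : ∀ ζ, ∫⁻ x, (Metric.ball (ψ x) T).indicator (fun ζ => ENNReal.ofReal (g ζ)) ζ ∂m ≤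
      (Metric.ball 0 (L + T)).indicator (fun ζ => ENNReal.ofReal (g ζ)) ζ * M := by
    intro ζ
    by_cases hζ : ζ ∈ Metric.ball (0 : E) (L + T)
    · rw [Set.indicator_of_mem hζ]
      calc ∫⁻ x, (Metric.ball (ψ x) T).indicator (fun ζ => ENNReal.ofReal (g ζ)) ζ ∂m
          = ∫⁻ x, (ψ ⁻¹' Metric.ball ζ T).indicator (fun _ => ENNReal.ofReal (g ζ)) x ∂m := by
            refine lintegral_congr fun x => ?_
            simp only [Set.indicator, Set.mem_preimage, Metric.mem_ball, dist_comm ζ]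
        _ = ENNReal.ofReal (g ζ) * m (ψ ⁻¹' Metric.ball ζ T) :=
            lintegral_indicator_const (measurableSet_ball.preimage hψ.measurable) _
        _ ≤ _ := by gcongr; exact hM ζ
    · rw [Set.indicator_of_notMem hζ, zero_mul]
      refine le_of_eq ((lintegral_congr_ae ?_).trans lintegral_zero)
      filter_upwards [hL] with x hx
      refine Set.indicator_of_notMem (fun h => hζ ?_) _
      rw [Metric.mem_ball, dist_eq_norm] at h
      rw [mem_ball_zero_iff]
      linarith [norm_le_norm_add_norm_sub' ζ (ψ x)]
  calc ∫⁻ x, ENNReal.ofReal (g (ψ x)) ∂m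
      ≤ ∫⁻ x, (ENNReal.ofReal C * (∫⁻ ζ,
          (Metric.ball (ψ x) T).indicator (fun ζ => ENNReal.ofReal (g ζ)) ζ)
            + ENNReal.ofReal δ) ∂m := by
        refine lintegral_mono fun x => ?_
        rw [lintegral_indicator measurableSet_ball, ← hofReal, ← ENNReal.ofReal_mul hC,
          ← ENNReal.ofReal_add (mul_nonneg hC (integral_nonneg fun _ => hg0 _)) hδ]
        exact ENNReal.ofReal_le_ofReal (hloc _)
    _ = ENNReal.ofReal C * (∫⁻ x, (∫⁻ ζ,
          (Metric.ball (ψ x) T).indicator (fun ζ => ENNReal.ofReal (g ζ)) ζ) ∂m)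
            + ENNReal.ofReal δ * m Set.univ := by
        rw [lintegral_add_right _ measurable_const, lintegral_const,
          lintegral_const_mul _ hker.lintegral_prod_right]
    _ ≤ ENNReal.ofReal C * (∫⁻ ζ, (Metric.ball 0 (L + T)).indicator
          (fun ζ => ENNReal.ofReal (g ζ)) ζ * M) + ENNReal.ofReal δ * M₀ := by
        rw [lintegral_lintegral_swap hker.aemeasurable]
        gcongr
        exact hinner _
    _ = _ := by
        rw [lintegral_mul_const _ (hgm.indicator measurableSet_ball),
          lintegral_indicator measurableSet_ball, ← hofReal, ← mul_assoc, ← ENNReal.ofReal_mul hC]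

end Sampling

end Energy

/-! ### Choice of scales as powers of the frequency. -/

section Scales

variable {E : Type*} [NormedAddCommGroup E] [InnerProductSpace ℝ E] [FiniteDimensional ℝ E]
  [MeasurableSpace E] [BorelSpace E]

instance (μ : Measure E) [SFinite μ] (r : ℝ) : SFinite (ballCountingMeasure μ r) := by
  unfold ballCountingMeasure
  infer_instance

lemma exists_ballCountingMeasure_univ_le {μ : Measure E} [IsProbabilityMeasure μ]
    (hμ : IsCompact μ.support) {α C : ℝ} (hC : 0 ≤ C) (hA : HasCoverExponent μ.support α C) :
    ∃ C' : ℝ, 0 ≤ C' ∧ ∀ r : ℝ, 0 < r → r < 1 →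
      ballCountingMeasure μ r Set.univ ≤ ENNReal.ofReal (C' * r ^ (-α)) := by
  obtain ⟨x, hx⟩ := Measure.nonempty_support (IsProbabilityMeasure.ne_zero μ)
  obtain ⟨R, hR0, hR⟩ := hμ.isBounded.subset_ball_lt 1 x
  have hR0' : 0 < R := one_pos.trans hR0
  refine ⟨C * R ^ α, by positivity, fun r hr hr1 => ?_⟩
  obtain ⟨t, ht, htc⟩ := hA r R hr (hr1.trans hR0) x hx
  refine (ballCountingMeasure_le MeasurableSet.univ (Measure.support_mem_ae (μ := μ))
    (t := t) ?_).trans ?_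
  · exact fun y hy => htc ⟨hR hy.2, hy.2⟩
  · rw [← ENNReal.ofReal_natCast]
    refine ENNReal.ofReal_le_ofReal (ht.trans (le_of_eq ?_))
    rw [Real.div_rpow hR0'.le hr.le, Real.rpow_neg hr.le]
    ring

/-- The small-ball estimate with `T = r ^ (-ε)`: enlarging the frequency ball costs at most the gap
`s' - s`, and `N ≥ s / ε` makes the tail at most `r ^ s`. -/
lemma exists_measure_ball_le_rpow (ν : Measure E) [IsProbabilityMeasure ν] {s s' C : ℝ}
    (hss' : s < s') (hC : 0 ≤ C)
    (h : ∀ R : ℝ, 1 ≤ R → ∫ ξ in Metric.ball (0 : E) R, ‖fourierTransform ν ξ‖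
      ≤ C * R ^ ((Module.finrank ℝ E : ℝ) - s')) :
    ∃ C' : ℝ, 0 ≤ C' ∧ ∀ r : ℝ, 0 < r → r < 1 → ν.real (Metric.ball 0 r) ≤ C' * r ^ s := by
  set d : ℝ := (Module.finrank ℝ E : ℝ) with hd
  set ε : ℝ := (s' - s) / (|d - s'| + 1) with hε
  have hε0 : 0 < ε := div_pos (by linarith) (by positivity)
  have hεd : ε * (d - s') ≤ s' - s := by
    calc ε * (d - s') ≤ ε * (|d - s'| + 1) := by
          gcongr
          linarith [le_abs_self (d - s')]
      _ = s' - s := by rw [hε]; field_simp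
  obtain ⟨N, hN⟩ := exists_nat_ge (s / ε)
  rw [div_le_iff₀ hε0] at hN
  obtain ⟨C₁, hC₁, hball⟩ := exists_measure_ball_le (E := E) N
  refine ⟨C₁ * C + C₁, by positivity, fun r hr hr1 => ?_⟩
  have h1 := hball ν r (r ^ (-ε)) hr (by positivity)
  have hTr : r ^ (-ε) / r = r ^ (-ε - 1) := by rw [Real.rpow_sub_one hr.ne']
  have hTr1 : 1 ≤ r ^ (-ε - 1) := Real.one_le_rpow_of_pos_of_le_one_of_nonpos hr hr1.le (by linarith)
  have h2 : r ^ Module.finrank ℝ E * ∫ ζ in Metric.ball (0 : E) (r ^ (-ε) / r),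
      ‖fourierTransform ν ζ‖ ≤ C * r ^ s := by
    rw [hTr]
    calc r ^ Module.finrank ℝ E * ∫ ζ in Metric.ball (0 : E) (r ^ (-ε - 1)), ‖fourierTransform ν ζ‖
        ≤ r ^ Module.finrank ℝ E * (C * (r ^ (-ε - 1)) ^ (d - s')) := by
          gcongr
          exact h _ hTr1
      _ = C * r ^ (d + (-ε - 1) * (d - s')) := by
          rw [← Real.rpow_mul hr.le, Real.rpow_add hr, hd, Real.rpow_natCast]
          ring
      _ ≤ C * r ^ s := by
          gcongr ?_ * ?_
          refine Real.rpow_le_rpow_of_exponent_ge hr hr1.le ?_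
          nlinarith
  have h3 : ((r ^ (-ε)) ^ N)⁻¹ ≤ r ^ s := by
    rw [← Real.rpow_natCast, ← Real.rpow_mul hr.le, ← Real.rpow_neg hr.le]
    refine Real.rpow_le_rpow_of_exponent_ge hr hr1.le ?_
    nlinarith
  calc ν.real (Metric.ball 0 r) ≤ _ := h1
    _ ≤ C₁ * (C * r ^ s) + C₁ * r ^ s := by gcongr
    _ = _ := by ring

/-- The energy of a Fourier transform sampled along dilated rotations of a lower Lipschitz map. -/
lemma exists_lintegral_fourierTransform_le {μ : Measure E} [IsProbabilityMeasure μ]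
    (hμ : IsCompact μ.support) {α C : ℝ} (hα : 0 < α) (hC : 0 ≤ C)
    (hA : HasCoverExponent μ.support α C) {φ : E → E} (hφ : Continuous φ) {𝒮 : Finset (Set E)}
    (h𝒮 : μ.support ⊆ ⋃ S ∈ 𝒮, S) {c : ℝ} (hc : 0 < c) (hc1 : c ≤ 1)
    (hφS : ∀ S ∈ 𝒮, LowerLipschitzOn c φ S)
    (ν : Measure E) [IsProbabilityMeasure ν] {ρ₀ : ℝ}
    (hν : ∀ᵐ x ∂ν, x ∈ Metric.closedBall (0 : E) ρ₀) {q Cq : ℝ} (hCq : 0 ≤ Cq)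
    (hq : ∀ R : ℝ, 1 ≤ R → ∫ ξ in Metric.ball (0 : E) R, ‖fourierTransform ν ξ‖ ≤ Cq * R ^ q)
    {c₀ : ℝ} (hc₀ : 0 < c₀) {σ β : ℝ} (hσ0 : 0 < σ) (hσ1 : σ ≤ 1)
    (hβ : α * σ + q * (1 - σ) / 2 < β) :
    ∃ C' : ℝ, 0 ≤ C' ∧ ∀ ξ : ℝ, 1 < |ξ| → ∀ (ρ : ℝ) (O : E ≃ₗᵢ[ℝ] E),
      c₀ * |ξ| ^ (-((1 + σ) / 2)) < ρ → ρ ≤ |ξ| ^ (-((1 + σ) / 2)) →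
      ∫⁻ x, ENNReal.ofReal ‖fourierTransform ν ((ρ * ξ) • O (φ x))‖
        ∂(ballCountingMeasure μ (|ξ| ^ (-((1 + σ) / 2)))) ≤ ENNReal.ofReal (C' * |ξ| ^ β) := by
  set gap := β - (α * σ + q * (1 - σ) / 2) with hgap
  have hgap0 : 0 < gap := by linarith
  -- Averaging at radius `X ^ ε` instead of `1` raises the exponent by `ε (α + q)`, which must fit
  -- in the gap; `N` then makes the tail beat the total mass `r ^ (-α)`.
  set ε : ℝ := gap / (α + |q| + 1) with hε
  have hε0 : 0 < ε := div_pos hgap0 (by positivity)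
  have hεq : ε * (α + q) ≤ gap := by
    calc ε * (α + q) ≤ ε * (α + |q| + 1) :=
          mul_le_mul_of_nonneg_left (by linarith [le_abs_self q]) hε0.le
      _ = gap := by rw [hε]; field_simp
  obtain ⟨N, hN⟩ := exists_nat_ge ((α * (1 + σ) / 2 - β) / ε)
  rw [div_le_iff₀ hε0] at hN
  obtain ⟨C₁, hC₁, hloc⟩ := exists_norm_fourierTransform_le (E := E) ρ₀ N
  obtain ⟨C₂, hC₂, huniv⟩ := exists_ballCountingMeasure_univ_le hμ hC hA
  obtain ⟨L, hL⟩ := hμ.exists_bound_of_continuousOn hφ.continuousOn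
  have hL' : ∀ x ∈ μ.support, ‖φ x‖ ≤ |L| := fun x hx => (hL x hx).trans (le_abs_self L)
  refine ⟨C₁ * (Cq * (|L| + 1) ^ q) * (𝒮.card * C * (2 / (c * c₀)) ^ α) + C₁ * C₂, by positivity,
    fun ξ hξ ρ O hρ1 hρ2 => ?_⟩
  set X := |ξ| with hX
  have hX0 : 0 < X := one_pos.trans hξ
  set r := X ^ (-((1 + σ) / 2)) with hr
  have hr0 : 0 < r := by positivity
  have hr1 : r < 1 := Real.rpow_lt_one_of_one_lt_of_neg hξ (by linarith)
  have hρ0 : 0 < ρ := lt_of_le_of_lt (by positivity) hρ1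
  set T := X ^ ε with hT
  have hT0 : 0 < T := by positivity
  have hT1 : 1 < T := Real.one_lt_rpow hξ hε0
  have hrX : r * X = X ^ ((1 - σ) / 2) := by
    rw [hr, ← Real.rpow_add_one hX0.ne']
    congr 1
    ring
  -- A fibre has diameter about `T / (X r)`, so in units of `r` it has size about `X ^ (σ + ε)`, the
  -- source of the covering exponent.
  have hrrX : X * r * r = X ^ (-σ) := by
    rw [mul_comm X r, hrX, hr, ← Real.rpow_add hX0]
    congr 1
    ring
  have hρX : |ρ * ξ| = ρ * X := by rw [abs_mul, abs_of_pos hρ0]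
  set ψ : E → E := fun x => (ρ * ξ) • O (φ x) with hψ
  have hψc : Continuous ψ := (O.continuous.comp hφ).const_smul _
  have hψS : ∀ S ∈ 𝒮, LowerLipschitzOn (ρ * X * c) ψ S := by
    intro S hS x hx y hy
    rw [hψ]
    simp only
    rw [← smul_sub, ← map_sub, norm_smul, LinearIsometryEquiv.norm_map, Real.norm_eq_abs, hρX,
      mul_assoc]
    gcongr
    exact hφS S hS x hx y hy
  have hψL : ∀ᵐ x ∂(ballCountingMeasure μ r), ‖ψ x‖ ≤ |L| * X ^ ((1 - σ) / 2) := by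
    refine (withDensity_absolutelyContinuous _ _).ae_le ?_
    filter_upwards [Measure.support_mem_ae (μ := μ)] with x hx
    rw [hψ]
    simp only
    rw [norm_smul, LinearIsometryEquiv.norm_map, Real.norm_eq_abs, hρX, mul_comm, ← hrX]
    gcongr
    exact hL' x hx
  have hrT : r < 2 * T / (ρ * X * c) := by
    rw [lt_div_iff₀ (by positivity)]
    have h1 : r * (ρ * X * c) ≤ 1 := by
      calc r * (ρ * X * c) ≤ r * (r * X * 1) := by gcongr
        _ = X ^ (-σ) := by rw [← hrrX]; ring
        _ ≤ 1 := Real.rpow_le_one_of_one_le_of_nonpos hξ.le (by linarith)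
    linarith
  have hfib : ∀ ζ, ballCountingMeasure μ r (ψ ⁻¹' Metric.ball ζ T) ≤
      ENNReal.ofReal (𝒮.card * C * (2 / (c * c₀)) ^ α * X ^ (α * (σ + ε))) := by
    intro ζ
    obtain ⟨t, ht, htc⟩ := exists_cover_preimage_ball hC hA h𝒮 (by positivity) hψS hr0 hrT ζ
    refine (ballCountingMeasure_le (measurableSet_ball.preimage hψc.measurable)
      (Measure.support_mem_ae (μ := μ)) htc).trans ?_
    rw [← ENNReal.ofReal_natCast]
    refine ENNReal.ofReal_le_ofReal (ht.trans ?_)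
    rw [mul_assoc (𝒮.card * C : ℝ)]
    gcongr ?_ * ?_
    have h1 : 2 * T / (ρ * X * c * r) ≤ 2 / (c * c₀) * X ^ (σ + ε) := by
      rw [div_le_iff₀ (by positivity)]
      calc 2 * T = 2 / (c * c₀) * X ^ (σ + ε) * (c₀ * (X * r * r) * c) := by
            rw [hrrX, hT, Real.rpow_add hX0, Real.rpow_neg hX0.le]
            field_simp
        _ = 2 / (c * c₀) * X ^ (σ + ε) * ((c₀ * r) * X * c * r) := by ring
        _ ≤ _ := by gcongr
    calc (2 * T / (ρ * X * c * r)) ^ α ≤ (2 / (c * c₀) * X ^ (σ + ε)) ^ α := by gcongr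
      _ = (2 / (c * c₀)) ^ α * X ^ (α * (σ + ε)) := by
          rw [Real.mul_rpow (by positivity) (by positivity), ← Real.rpow_mul hX0.le, mul_comm α]
  have hmain := lintegral_comp_le_of_local_average (ballCountingMeasure μ r)
    (continuous_fourierTransform ν).norm (fun _ => norm_nonneg _) hC₁
    (by positivity : 0 ≤ C₁ * (T ^ N)⁻¹) (fun η => hloc ν hν η T hT0) hψc hψL hfib
    (huniv r hr0 hr1)
  refine hmain.trans ?_
  have hint0 : 0 ≤ ∫ ζ in Metric.ball (0 : E) (|L| * X ^ ((1 - σ) / 2) + T),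
    ‖fourierTransform ν ζ‖ := integral_nonneg fun _ => norm_nonneg _
  rw [← ENNReal.ofReal_mul (by positivity), ← ENNReal.ofReal_mul (by positivity),
    ← ENNReal.ofReal_add (by positivity) (by positivity)]
  refine ENNReal.ofReal_le_ofReal ?_
  have hball : ∫ ζ in Metric.ball (0 : E) (|L| * X ^ ((1 - σ) / 2) + T), ‖fourierTransform ν ζ‖
      ≤ Cq * (|L| + 1) ^ q * X ^ (q * ((1 - σ) / 2 + ε)) := by
    have h1 : |L| * X ^ ((1 - σ) / 2) + T ≤ (|L| + 1) * X ^ ((1 - σ) / 2 + ε) := by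
      rw [add_mul, one_mul]
      have h3 : X ^ ((1 - σ) / 2) ≤ X ^ ((1 - σ) / 2 + ε) :=
        Real.rpow_le_rpow_of_exponent_le hξ.le (by linarith)
      have h4 : T ≤ X ^ ((1 - σ) / 2 + ε) :=
        Real.rpow_le_rpow_of_exponent_le hξ.le (by linarith)
      gcongr
    have h2 : 1 ≤ (|L| + 1) * X ^ ((1 - σ) / 2 + ε) := by
      refine one_le_mul_of_one_le_of_one_le (by linarith [abs_nonneg L]) ?_
      exact Real.one_le_rpow hξ.le (by linarith)
    calc ∫ ζ in Metric.ball (0 : E) (|L| * X ^ ((1 - σ) / 2) + T), ‖fourierTransform ν ζ‖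
        ≤ ∫ ζ in Metric.ball (0 : E) ((|L| + 1) * X ^ ((1 - σ) / 2 + ε)),
            ‖fourierTransform ν ζ‖ := by
          refine setIntegral_mono_set ?_ (.of_forall fun _ => norm_nonneg _)
            (Metric.ball_subset_ball h1).eventuallyLE
          exact ((continuous_fourierTransform ν).norm.continuousOn.integrableOn_compact
            (isCompact_closedBall _ _)).mono_set Metric.ball_subset_closedBall
      _ ≤ Cq * ((|L| + 1) * X ^ ((1 - σ) / 2 + ε)) ^ q := hq _ h2
      _ = _ := by
          rw [Real.mul_rpow (by positivity) (by positivity), ← Real.rpow_mul hX0.le, mul_comm q]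
          ring
  have hfirst : X ^ (q * ((1 - σ) / 2 + ε)) * X ^ (α * (σ + ε)) ≤ X ^ β := by
    rw [← Real.rpow_add hX0]
    refine Real.rpow_le_rpow_of_exponent_le hξ.le ?_
    linarith
  have hsecond : (T ^ N)⁻¹ * r ^ (-α) ≤ X ^ β := by
    rw [hT, hr, ← Real.rpow_natCast, ← Real.rpow_mul hX0.le, ← Real.rpow_mul hX0.le,
      ← Real.rpow_neg hX0.le, ← Real.rpow_add hX0]
    refine Real.rpow_le_rpow_of_exponent_le hξ.le ?_
    linarith
  calc C₁ * (∫ ζ in Metric.ball (0 : E) (|L| * X ^ ((1 - σ) / 2) + T), ‖fourierTransform ν ζ‖) *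
          (𝒮.card * C * (2 / (c * c₀)) ^ α * X ^ (α * (σ + ε))) +
        C₁ * (T ^ N)⁻¹ * (C₂ * r ^ (-α))
      ≤ C₁ * (Cq * (|L| + 1) ^ q * X ^ (q * ((1 - σ) / 2 + ε))) *
          (𝒮.card * C * (2 / (c * c₀)) ^ α * X ^ (α * (σ + ε))) +
        C₁ * (T ^ N)⁻¹ * (C₂ * r ^ (-α)) := by gcongr
    _ = C₁ * (Cq * (|L| + 1) ^ q) * (𝒮.card * C * (2 / (c * c₀)) ^ α) *
          (X ^ (q * ((1 - σ) / 2 + ε)) * X ^ (α * (σ + ε))) +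
        C₁ * C₂ * ((T ^ N)⁻¹ * r ^ (-α)) := by ring
    _ ≤ C₁ * (Cq * (|L| + 1) ^ q) * (𝒮.card * C * (2 / (c * c₀)) ^ α) * X ^ β +
        C₁ * C₂ * X ^ β := by gcongr
    _ = _ := by ring

end Scales

/-! ### Decay of averages and comparison of dimensions. -/

section Average

variable {k : ℕ}

/-- The averages of `μ̂` along dilated rotations of `φ`, at the scale at which a phase of frequency
`ξ` linearizes with error `|ξ|^{-σ}`, decay like `|ξ|^β`. -/
def HasAverageDecay (μ : Measure (EuclideanSpace ℝ (Fin k)))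
    (φ : EuclideanSpace ℝ (Fin k) → EuclideanSpace ℝ (Fin k)) (σ β : ℝ) : Prop :=
  ∀ c₀ : ℝ, 0 < c₀ → ∃ B : ℝ, 0 ≤ B ∧ ∀ ξ : ℝ, 1 < |ξ| →
    ∀ (ρ : ℝ) (O : EuclideanSpace ℝ (Fin k) ≃ₗᵢ[ℝ] EuclideanSpace ℝ (Fin k)),
      c₀ * |ξ| ^ (-((1 + σ) / 2)) < ρ → ρ ≤ |ξ| ^ (-((1 + σ) / 2)) →
      ∫ x, ‖fourierTransform μ ((ρ * ξ) • O (φ x))‖ ∂μ ≤ B * |ξ| ^ β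

lemma hasFourierDecay_of_hasAverageDecay {μ : Measure (EuclideanSpace ℝ (Fin k))}
    (hμ : IsNonExpandingSelfSimilar μ) {f : EuclideanSpace ℝ (Fin k) → ℝ} (hf : ContDiff ℝ 2 f)
    {σ β : ℝ} (hσ : 0 < σ) (hβ : β < -σ) (h : HasAverageDecay μ (gradient f) σ β) :
    HasFourierDecay (μ.map f) σ := by
  have := hμ.isProbabilityMeasure
  have : IsProbabilityMeasure (μ.map f) :=
    Measure.isProbabilityMeasure_map hf.continuous.aemeasurable
  obtain ⟨c, C, hc, hC, hred⟩ := hμ.exists_norm_fourierTransform_map_le hf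
  -- Chosen so that the count `r ^ (-ε)` of linear parts uses up exactly the surplus of `β` over
  -- `-σ`.
  set ε : ℝ := 2 * (-σ - β) / (1 + σ) with hε
  obtain ⟨C', hC', hred⟩ := hred ε (div_pos (by linarith) (by linarith))
  obtain ⟨B, hB, havg⟩ := h c hc
  refine ⟨C' * B + C + 1, fun ξ hξ => ?_⟩
  have hX0 : 0 < |ξ| := abs_pos.2 hξ
  have hpow : 0 ≤ |ξ| ^ (-σ) := by positivity
  by_cases hX : 1 < |ξ|
  · have h1 := hred ξ (|ξ| ^ (-((1 + σ) / 2))) (B * |ξ| ^ β) (by positivity)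
      (Real.rpow_lt_one_of_one_lt_of_neg hX (by linarith)) (havg ξ hX)
    have h2 : (|ξ| ^ (-((1 + σ) / 2))) ^ (-ε) * |ξ| ^ β = |ξ| ^ (-σ) := by
      rw [← Real.rpow_mul hX0.le, ← Real.rpow_add hX0]
      congr 1
      rw [hε]
      have : (1 + σ) ≠ 0 := by linarith
      field_simp
      ring
    have h3 : |ξ| * (|ξ| ^ (-((1 + σ) / 2))) ^ 2 = |ξ| ^ (-σ) := by
      rw [← Real.rpow_natCast, ← Real.rpow_mul hX0.le, mul_comm, ← Real.rpow_add_one hX0.ne']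
      congr 1
      push_cast
      ring
    calc ‖fourierTransform (μ.map f) ξ‖ ≤ _ := h1
      _ = C' * B * ((|ξ| ^ (-((1 + σ) / 2))) ^ (-ε) * |ξ| ^ β)
          + C * (|ξ| * (|ξ| ^ (-((1 + σ) / 2))) ^ 2) := by ring
      _ = (C' * B + C) * |ξ| ^ (-σ) := by rw [h2, h3]; ring
      _ ≤ _ := by nlinarith
  · have h1 : 1 ≤ |ξ| ^ (-σ) :=
      Real.one_le_rpow_of_pos_of_le_one_of_nonpos hX0 (not_lt.1 hX) (by linarith)
    have h2 : 0 ≤ C' * B + C := by positivity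
    nlinarith [norm_fourierTransform_le_one (μ.map f) ξ]

lemma integral_le_of_lintegral_ofReal_le {X : Type*} [MeasurableSpace X] {μ : Measure X}
    {u : X → ℝ} (hu : Integrable u μ) (hu0 : ∀ x, 0 ≤ u x) {B : ℝ} (hB : 0 ≤ B)
    (h : ∫⁻ x, ENNReal.ofReal (u x) ∂μ ≤ ENNReal.ofReal B) : ∫ x, u x ∂μ ≤ B := by
  rw [← ofReal_integral_eq_lintegral_ofReal hu (.of_forall hu0)] at h
  exact (ENNReal.ofReal_le_ofReal_iff hB).1 h

lemma lintegral_measure_ball_le {μ : Measure (EuclideanSpace ℝ (Fin k))} [IsProbabilityMeasure μ]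
    {r b : ℝ} (h : (diffMeasure μ).real (Metric.ball 0 r) ≤ b) :
    ∫⁻ x, μ (Metric.ball x r) ∂μ ≤ ENNReal.ofReal b := by
  rw [← diffMeasure_ball, ← ofReal_measureReal]
  exact ENNReal.ofReal_le_ofReal h

lemma exists_integral_diffMeasure_le (hk : 1 ≤ k) {s : ℝ}
    (μ : Measure (EuclideanSpace ℝ (Fin k))) [IsProbabilityMeasure μ] (hs : s < fourierDim 2 μ) :
    ∃ C : ℝ, 0 ≤ C ∧ ∀ R : ℝ, 1 ≤ R →
      ∫ ξ in Metric.ball (0 : EuclideanSpace ℝ (Fin k)) R, ‖fourierTransform (diffMeasure μ) ξ‖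
        ≤ C * R ^ ((k : ℝ) - s) := by
  obtain ⟨C, hC, h⟩ := exists_integral_le_of_lt_fourierDim hk zero_le_two μ hs
  refine ⟨C, hC, fun R hR => ?_⟩
  simpa [norm_fourierTransform_diffMeasure] using h R hR

lemma exists_diffMeasure_ball_le (hk : 1 ≤ k) {s : ℝ}
    (μ : Measure (EuclideanSpace ℝ (Fin k))) [IsProbabilityMeasure μ] (hs : s < fourierDim 2 μ) :
    ∃ C : ℝ, 0 ≤ C ∧ ∀ r : ℝ, 0 < r → r < 1 →
      (diffMeasure μ).real (Metric.ball 0 r) ≤ C * r ^ s := by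
  obtain ⟨s', hss', hs'⟩ := exists_between hs
  obtain ⟨C, hC, h⟩ := exists_integral_diffMeasure_le hk μ hs'
  exact exists_measure_ball_le_rpow (diffMeasure μ) hss' hC (by simpa using h)

lemma nonpos_of_one_le_mul_rpow {C e : ℝ} (hC : 0 ≤ C)
    (h : ∀ r : ℝ, 0 < r → r < 1 → 1 ≤ C * r ^ e) : e ≤ 0 := by
  by_contra! he
  have h1 : (0 : ℝ) < 1 / (C + 2) := by positivity
  have h2 : 1 / (C + 2) < 1 := by
    rw [div_lt_one (by positivity)]
    linarith
  -- At this radius `C * r ^ e = C / (C + 2) < 1`.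
  have h3 := h ((1 / (C + 2)) ^ e⁻¹) (by positivity)
    (Real.rpow_lt_one h1.le h2 (inv_pos.2 he))
  rw [← Real.rpow_mul h1.le, inv_mul_cancel₀ he.ne', Real.rpow_one, mul_one_div,
    le_div_iff₀ (by positivity)] at h3
  linarith

/-- The lower correlation dimension is at most the Assouad dimension of the support. -/
lemma fourierDim_two_le_assouadDim (hk : 1 ≤ k) {μ : Measure (EuclideanSpace ℝ (Fin k))}
    [IsProbabilityMeasure μ] (hμ : IsCompact μ.support) :
    fourierDim 2 μ ≤ assouadDim μ.support := by
  refine le_of_forall_gt_imp_ge_of_dense fun α hα => le_of_forall_lt_imp_le_of_dense fun s hs => ?_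
  obtain ⟨hα0, C, hC, hA⟩ := exists_cover_of_assouadDim_lt hα
  obtain ⟨C₁, hC₁, hcount⟩ := exists_ballCountingMeasure_univ_le hμ hC.le hA
  obtain ⟨C₂, hC₂, hball⟩ := exists_diffMeasure_ball_le hk μ hs
  have key : (s - α) / 2 ≤ 0 := by
    refine nonpos_of_one_le_mul_rpow (C := C₁ + C₂) (by positivity) fun r hr hr1 => ?_
    -- The balancing choice: correlation term and counting term both become `r ^ ((s - α) / 2)`,
    -- while their sum dominates the total mass one.
    set t := r ^ (-((s + α) / 2)) with ht
    have ht0 : 0 < t := by positivity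
    have h1 := lintegral_le_add_lintegral_ballCountingMeasure (μ := μ) hr ht0
      (u := fun _ => 1) measurable_const fun _ => zero_le_one
    simp only [ENNReal.ofReal_one, one_pow, lintegral_const, measure_univ, one_mul] at h1
    have h2 : (1 : ℝ≥0∞) ≤ ENNReal.ofReal (t * (C₂ * r ^ s) + t⁻¹ * (C₁ * r ^ (-α))) := by
      rw [ENNReal.ofReal_add (by positivity) (by positivity), ENNReal.ofReal_mul ht0.le,
        ENNReal.ofReal_mul (inv_pos.2 ht0).le]
      refine h1.trans ?_
      gcongr
      · exact lintegral_measure_ball_le (hball r hr hr1)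
      · exact hcount r hr hr1
    rw [ENNReal.one_le_ofReal] at h2
    have h3 : t * r ^ s = r ^ ((s - α) / 2) := by
      rw [ht, ← Real.rpow_add hr]
      congr 1
      ring
    have h4 : t⁻¹ * r ^ (-α) = r ^ ((s - α) / 2) := by
      rw [ht, ← Real.rpow_neg hr.le, ← Real.rpow_add hr]
      congr 1
      ring
    calc 1 ≤ _ := h2
      _ = C₂ * (t * r ^ s) + C₁ * (t⁻¹ * r ^ (-α)) := by ring
      _ = _ := by rw [h3, h4]; ring
  linarith

/-- The Frostman exponent is at most the Assouad dimension of the support. -/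
lemma frostmanExponent_le_assouadDim {μ : Measure (EuclideanSpace ℝ (Fin k))}
    [IsProbabilityMeasure μ] (hμ : IsCompact μ.support) :
    frostmanExponent μ ≤ assouadDim μ.support := by
  refine le_of_forall_gt_imp_ge_of_dense fun α hα => le_of_forall_lt_imp_le_of_dense fun s hs => ?_
  obtain ⟨hα0, C, hC, hA⟩ := exists_cover_of_assouadDim_lt hα
  obtain ⟨C₁, hC₁, hcount⟩ := exists_ballCountingMeasure_univ_le hμ hC.le hA
  obtain ⟨C₂, hC₂, hball⟩ := exists_measure_ball_le_of_lt_frostmanExponent μ hs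
  have key : s - α ≤ 0 := by
    refine nonpos_of_one_le_mul_rpow (C := C₂ * C₁) (by positivity) fun r hr hr1 => ?_
    have h1 := lintegral_le_mul_lintegral_ballCountingMeasure (μ := μ) hr
      (W := ENNReal.ofReal (C₂ * r ^ s)) (fun x => by
        rw [← ofReal_measureReal]
        exact ENNReal.ofReal_le_ofReal (hball x r hr hr1.le)) (u := fun _ => 1) measurable_const
    simp only [lintegral_const, measure_univ, one_mul] at h1
    have h2 : (1 : ℝ≥0∞) ≤ ENNReal.ofReal ((C₂ * r ^ s) * (C₁ * r ^ (-α))) := by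
      rw [ENNReal.ofReal_mul (by positivity)]
      refine h1.trans ?_
      gcongr
      exact hcount r hr hr1
    rw [ENNReal.one_le_ofReal] at h2
    calc 1 ≤ _ := h2
      _ = C₂ * C₁ * (r ^ s * r ^ (-α)) := by ring
      _ = _ := by rw [← Real.rpow_add hr, sub_eq_add_neg]
  linarith

lemma integrable_norm_fourierTransform_comp (μ : Measure (EuclideanSpace ℝ (Fin k)))
    [IsProbabilityMeasure μ] {ψ : EuclideanSpace ℝ (Fin k) → EuclideanSpace ℝ (Fin k)}
    (hψ : Continuous ψ) : Integrable (fun x => ‖fourierTransform μ (ψ x)‖) μ :=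
  Integrable.of_bound (C := 1)
    ((continuous_fourierTransform μ).comp hψ).norm.aestronglyMeasurable
    (.of_forall fun x => by rw [norm_norm]; exact norm_fourierTransform_le_one μ _)

lemma exists_ae_mem_closedBall {μ : Measure (EuclideanSpace ℝ (Fin k))}
    (hμ : IsCompact μ.support) :
    ∃ ρ : ℝ, ∀ᵐ x ∂μ, x ∈ Metric.closedBall (0 : EuclideanSpace ℝ (Fin k)) ρ := by
  obtain ⟨ρ, hρ⟩ := hμ.isBounded.subset_closedBall (0 : EuclideanSpace ℝ (Fin k))
  exact ⟨ρ, Filter.mem_of_superset Measure.support_mem_ae hρ⟩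

variable {μ : Measure (EuclideanSpace ℝ (Fin k))} [IsProbabilityMeasure μ]
  {φ : EuclideanSpace ℝ (Fin k) → EuclideanSpace ℝ (Fin k)}

/-- Decay of averages by Cauchy–Schwarz and the lower correlation dimension. -/
lemma hasAverageDecay_of_lt_fourierDim_two (hk : 1 ≤ k) (hμ : IsCompact μ.support)
    (hφ : Continuous φ) {𝒮 : Finset (Set (EuclideanSpace ℝ (Fin k)))}
    (h𝒮 : μ.support ⊆ ⋃ S ∈ 𝒮, S) {c : ℝ} (hc : 0 < c) (hc1 : c ≤ 1)
    (hφS : ∀ S ∈ 𝒮, LowerLipschitzOn c φ S) {s α σ β : ℝ} (hs : s < fourierDim 2 μ)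
    (hα : assouadDim μ.support < α) (hσ0 : 0 < σ) (hσ1 : σ ≤ 1)
    (hβ : α * σ + ((k : ℝ) - s) * (1 - σ) / 2 < β) :
    HasAverageDecay μ φ σ ((β - s * (1 + σ) / 2) / 2) := by
  intro c₀ hc₀
  obtain ⟨hα0, C, hC, hA⟩ := exists_cover_of_assouadDim_lt hα
  obtain ⟨ρ₀, hρ₀⟩ := exists_ae_mem_closedBall hμ
  obtain ⟨C₁, hC₁, hq⟩ := exists_integral_diffMeasure_le hk μ hs
  obtain ⟨C₂, hC₂, hball⟩ := exists_diffMeasure_ball_le hk μ hs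
  obtain ⟨C₃, hC₃, henergy⟩ := exists_lintegral_fourierTransform_le hμ hα0 hC.le hA hφ h𝒮 hc hc1
    hφS (diffMeasure μ) (diffMeasure_support μ hρ₀) hC₁ hq hc₀ hσ0 hσ1 hβ
  refine ⟨C₂ + C₃, by positivity, fun ξ hξ ρ O hρ1 hρ2 => ?_⟩
  have hE := henergy ξ hξ ρ O hρ1 hρ2
  set X := |ξ| with hX
  have hX0 : 0 < X := one_pos.trans hξ
  set r := X ^ (-((1 + σ) / 2)) with hr
  have hr0 : 0 < r := by positivity
  have hr1 : r < 1 := Real.rpow_lt_one_of_one_lt_of_neg hξ (by linarith)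
  have hψ : Continuous fun x => (ρ * ξ) • O (φ x) :=
    (continuous_const_smul (ρ * ξ)).comp (O.continuous.comp hφ)
  refine integral_le_of_lintegral_ofReal_le (integrable_norm_fourierTransform_comp μ hψ)
    (fun _ => norm_nonneg _) (by positivity) ?_
  -- This `t` equalizes the correlation term `t * r ^ s` and the energy term `t⁻¹ * X ^ β`.
  set t := X ^ ((β + s * (1 + σ) / 2) / 2) with ht
  have ht0 : 0 < t := by positivity
  refine (lintegral_le_add_lintegral_ballCountingMeasure hr0 ht0
    ((continuous_fourierTransform μ).comp hψ).norm.measurable fun _ => norm_nonneg _).trans ?_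
  simp only [norm_fourierTransform_diffMeasure] at hE
  have h1 : t * r ^ s = X ^ ((β - s * (1 + σ) / 2) / 2) := by
    rw [ht, hr, ← Real.rpow_mul hX0.le, ← Real.rpow_add hX0]
    congr 1
    ring
  have h2 : t⁻¹ * X ^ β = X ^ ((β - s * (1 + σ) / 2) / 2) := by
    rw [ht, ← Real.rpow_neg hX0.le, ← Real.rpow_add hX0]
    congr 1
    ring
  calc ENNReal.ofReal t * ∫⁻ x, μ (Metric.ball x r) ∂μ + ENNReal.ofReal t⁻¹ *
        ∫⁻ x, ENNReal.ofReal (‖fourierTransform μ ((ρ * ξ) • O (φ x))‖ ^ 2)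
          ∂(ballCountingMeasure μ r)
      ≤ ENNReal.ofReal t * ENNReal.ofReal (C₂ * r ^ s) +
          ENNReal.ofReal t⁻¹ * ENNReal.ofReal (C₃ * X ^ β) := by
        gcongr
        exact lintegral_measure_ball_le (hball r hr0 hr1)
    _ = ENNReal.ofReal (C₂ * (t * r ^ s) + C₃ * (t⁻¹ * X ^ β)) := by
        rw [← ENNReal.ofReal_mul ht0.le, ← ENNReal.ofReal_mul (inv_pos.2 ht0).le,
          ← ENNReal.ofReal_add (by positivity) (by positivity)]
        congr 1
        ring
    _ = _ := by rw [h1, h2, add_mul]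

/-- Decay of averages by the Frostman exponent and the Fourier `l¹` dimension. -/
lemma hasAverageDecay_of_lt_fourierDim_one (hk : 1 ≤ k) (hμ : IsCompact μ.support)
    (hφ : Continuous φ) {𝒮 : Finset (Set (EuclideanSpace ℝ (Fin k)))}
    (h𝒮 : μ.support ⊆ ⋃ S ∈ 𝒮, S) {c : ℝ} (hc : 0 < c) (hc1 : c ≤ 1)
    (hφS : ∀ S ∈ 𝒮, LowerLipschitzOn c φ S) {d s α σ β : ℝ} (hd : d < frostmanExponent μ)
    (hs : s < fourierDim 1 μ) (hα : assouadDim μ.support < α) (hσ0 : 0 < σ) (hσ1 : σ ≤ 1)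
    (hβ : α * σ + ((k : ℝ) - s) * (1 - σ) / 2 < β) :
    HasAverageDecay μ φ σ (β - d * (1 + σ) / 2) := by
  intro c₀ hc₀
  obtain ⟨hα0, C, hC, hA⟩ := exists_cover_of_assouadDim_lt hα
  obtain ⟨ρ₀, hρ₀⟩ := exists_ae_mem_closedBall hμ
  obtain ⟨C₁, hC₁, hq⟩ := exists_integral_le_of_lt_fourierDim hk zero_le_one μ hs
  obtain ⟨C₂, hC₂, hball⟩ := exists_measure_ball_le_of_lt_frostmanExponent μ hd
  obtain ⟨C₃, hC₃, henergy⟩ := exists_lintegral_fourierTransform_le hμ hα0 hC.le hA hφ h𝒮 hc hc1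
    hφS μ hρ₀ hC₁ (by simpa using hq) hc₀ hσ0 hσ1 hβ
  refine ⟨C₂ * C₃, by positivity, fun ξ hξ ρ O hρ1 hρ2 => ?_⟩
  have hE := henergy ξ hξ ρ O hρ1 hρ2
  set X := |ξ| with hX
  have hX0 : 0 < X := one_pos.trans hξ
  set r := X ^ (-((1 + σ) / 2)) with hr
  have hr0 : 0 < r := by positivity
  have hr1 : r < 1 := Real.rpow_lt_one_of_one_lt_of_neg hξ (by linarith)
  have hψ : Continuous fun x => (ρ * ξ) • O (φ x) :=
    (continuous_const_smul (ρ * ξ)).comp (O.continuous.comp hφ)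
  refine integral_le_of_lintegral_ofReal_le (integrable_norm_fourierTransform_comp μ hψ)
    (fun _ => norm_nonneg _) (by positivity) ?_
  refine (lintegral_le_mul_lintegral_ballCountingMeasure hr0
    (W := ENNReal.ofReal (C₂ * r ^ d)) (fun x => by
      rw [← ofReal_measureReal]
      exact ENNReal.ofReal_le_ofReal (hball x r hr0 hr1.le))
    ((continuous_fourierTransform μ).comp hψ).norm.measurable.ennreal_ofReal).trans ?_
  calc ENNReal.ofReal (C₂ * r ^ d) * _
      ≤ ENNReal.ofReal (C₂ * r ^ d) * ENNReal.ofReal (C₃ * X ^ β) := by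
        gcongr
        exact hE
    _ = ENNReal.ofReal (C₂ * C₃ * (X ^ β * r ^ d)) := by
        rw [← ENNReal.ofReal_mul (by positivity)]
        congr 1
        ring
    _ = _ := by
        rw [hr, ← Real.rpow_mul hX0.le, ← Real.rpow_add hX0]
        congr 3
        ring

end Average

end FourierDecay

/-! ### Optimization of the exponents. -/

theorem theorem1p1 (k : ℕ) (hk : 1 ≤ k)
    (μ : MeasureTheory.Measure (EuclideanSpace ℝ (Fin k)))
    (hμ : FourierDecay.IsNonExpandingSelfSimilar μ)
    (κ₁ κ₂ d_inf κ_star : ℝ)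
    (hκ₁ : κ₁ = FourierDecay.fourierDim 1 μ)
    (hκ₂ : κ₂ = FourierDecay.fourierDim 2 μ)
    (hd_inf : d_inf = FourierDecay.frostmanExponent μ)
    (hκ_star : κ_star = FourierDecay.assouadDim μ.support)
    (hdim : (k : ℝ) / 2 < κ₂)
    (f : EuclideanSpace ℝ (Fin k) → ℝ) (hf : ContDiff ℝ 2 f)
    (hcurv : ∀ x ∈ μ.support, FourierDecay.graphGaussianCurvature f x ≠ 0) :
    (∃ σ : ℝ, 0 < σ ∧ FourierDecay.HasFourierDecay (μ.map f) σ) ∧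
    ∀ σ : ℝ, 0 < σ →
      (σ < (2 * κ₂ - k) / (4 + 2 * κ_star - k) ∨
        ((k : ℝ) < d_inf + κ₁ ∧
          σ < (d_inf + κ₁ - k) / (2 - k + 2 * κ_star + κ₁ - d_inf))) →
      FourierDecay.HasFourierDecay (μ.map f) σ := by
  open FourierDecay in
  have := hμ.isProbabilityMeasure
  have hX := hμ.isCompact_support
  have hφ := contDiff_gradient hf
  obtain ⟨c, 𝒮, hc, h𝒮, hS⟩ := exists_finite_cover_lowerLipschitzOn hφ hX
    fun x hx => injective_fderiv_gradient_of_curvature_ne_zero hf (hcurv x hx)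
  have hS' : ∀ S ∈ 𝒮, LowerLipschitzOn (min c 1) (gradient f) S := fun S hS₀ x hx y hy =>
    (mul_le_mul_of_nonneg_right (min_le_left _ _) (norm_nonneg _)).trans (hS S hS₀ x hx y hy)
  have hcorr : κ₂ ≤ κ_star := by
    rw [hκ₂, hκ_star]
    exact fourierDim_two_le_assouadDim hk hX
  have hfrost : d_inf ≤ κ_star := by
    rw [hd_inf, hκ_star]
    exact frostmanExponent_le_assouadDim hX
  have hden : 0 < 4 + 2 * κ_star - k := by linarith
  have hfirst : ∀ σ : ℝ, 0 < σ → σ < (2 * κ₂ - k) / (4 + 2 * κ_star - k) →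
      HasFourierDecay (μ.map f) σ := by
    intro σ hσ0 hσ
    rw [lt_div_iff₀ hden] at hσ
    -- Since `κ₂ ≤ κ_star`, the numerator is smaller than the denominator.
    have hσ1 : σ ≤ 1 := by nlinarith
    set g := 2 * κ₂ - k - σ * (4 + 2 * κ_star - k) with hg
    -- Moving the dimensions by `δ` costs `2 δ (1 + σ) = g / 2` in twice the inequality needed for
    -- `β`, whose slack at `δ = 0` is `g`.
    set δ := g / (4 * (1 + σ)) with hδ
    have hδ0 : 0 < δ := div_pos (by linarith) (by linarith)
    have hδg : δ * (4 * (1 + σ)) = g := div_mul_cancel₀ _ (by linarith)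
    obtain ⟨β, hβ1, hβ2⟩ : ∃ β, (κ_star + δ) * σ + ((k : ℝ) - (κ₂ - δ)) * (1 - σ) / 2 < β ∧
        β < (κ₂ - δ) * (1 + σ) / 2 - 2 * σ := by
      refine exists_between ?_
      nlinarith
    refine hasFourierDecay_of_hasAverageDecay hμ hf hσ0 ?_
      (hasAverageDecay_of_lt_fourierDim_two hk hX hφ.continuous h𝒮 (lt_min hc one_pos)
        (min_le_right _ _) hS' (s := κ₂ - δ) (α := κ_star + δ) (by linarith) (by linarith) hσ0 hσ1
        hβ1)
    linarith
  refine ⟨?_, ?_⟩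
  · obtain ⟨σ, hσ0, hσ⟩ := exists_between
      (div_pos (by linarith : 0 < 2 * κ₂ - k) hden)
    exact ⟨σ, hσ0, hfirst σ hσ0 hσ⟩
  · rintro σ hσ0 (hσ | ⟨hpos, hσ⟩)
    · exact hfirst σ hσ0 hσ
    · have hden' : 0 < 2 - k + 2 * κ_star + κ₁ - d_inf := by
        by_contra! h
        exact (hσ0.trans hσ).not_ge (div_nonpos_of_nonneg_of_nonpos (by linarith) h)
      rw [lt_div_iff₀ hden'] at hσ
      -- Here `d_inf ≤ κ_star` puts the numerator below the denominator.
      have hσ1 : σ ≤ 1 := by nlinarith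
      set g := d_inf + κ₁ - k - σ * (2 - k + 2 * κ_star + κ₁ - d_inf) with hg
      set δ := g / (4 * (1 + σ)) with hδ
      have hδ0 : 0 < δ := div_pos (by linarith) (by linarith)
      have hδg : δ * (4 * (1 + σ)) = g := div_mul_cancel₀ _ (by linarith)
      obtain ⟨β, hβ1, hβ2⟩ : ∃ β, (κ_star + δ) * σ + ((k : ℝ) - (κ₁ - δ)) * (1 - σ) / 2 < β ∧
          β < (d_inf - δ) * (1 + σ) / 2 - σ := by
        refine exists_between ?_
        nlinarith
      refine hasFourierDecay_of_hasAverageDecay hμ hf hσ0 ?_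
        (hasAverageDecay_of_lt_fourierDim_one hk hX hφ.continuous h𝒮 (lt_min hc one_pos)
          (min_le_right _ _) hS' (d := d_inf - δ) (s := κ₁ - δ) (α := κ_star + δ) (by linarith)
          (by linarith) (by linarith) hσ0 hσ1 hβ1)
      linarith
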